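/- \textbf{Setting.} Fix $\ell>0$, $r_0\in(0,\ell/2)$, $e_0\neq 0$, $\gamma>0$, Lamé coefficients $\mu>0$, $\mu+\lambda>0$, a volume $d>0$, a finite (possibly empty) family $\mathbf B=\{\mathbf b_1,\dots,\mathbf b_k\}\subset\mathbb R^2$ of Burgers vectors, and a nonnegative, radially symmetric $\varrho\in C^\infty_c(B_1(0))$ with $\int_{\mathbb R^2}\varrho\,dz=1$; put $\varrho_{r_0}(z)=r_0^{-2}\varrho(z/r_0)$. \emph{Profiles.} $AP(0,\ell)$ is the set of lower semicontinuous $\ell$-periodic functions $h:\mathbb R\to[0,\infty)$ of finite pointwise total variation on $(0,\ell)$. With $h(x\pm)$ the one-sided limits, let $h^-(x)=\min\{h(x+),h(x-)\}$, $h^+(x)=\max\{h(x+),h(x-)\}$, and $$\Omega_h=\{(x,y): 0\le x<\ell,\ 0<y<h(x)\},\qquad \Omega_h^\#=\{(x,y): x\in\mathbb R,\ 0<y<h(x)\},$$ $$\Gamma_h=\{(x,y): 0\le x<\ell,\ h^-(x)\le y\le h^+(x)\},$$ $$\Sigma_h=\{(x,y): 0\le x<\ell,\ h(x)<h^-(x),\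 h(x)\le y\le h^-(x)\}\quad\text{(vertical cuts).}$$ \emph{Admissible triples.} $X(e_0;\mathbf B)$ is the set of triples $(h,\sigma,H)$ such that $h\in AP(0,\ell)$; $\sigma=\sum_{i=1}^k\mathbf b_i\sum_{m\in\mathbb Z}\delta_{z_i+m\ell\mathbf e_1}$ for some (not necessarily distinct) $z_i\in\Omega_h$ with $B_{r_0}(z_i)\subset\Omega_h^\#$; and $H:\Omega_h\to\mathbb R^{2\times2}$ is a field whose $\ell$-periodic extension $H^\#$ in $x$ is locally square integrable in $\Omega_h^\#$ up to the interface $\{y=0\}$ (that is, on $K\cap\Omega_h^\#$ for every compact $K\subset\{(x,y): y<h(x)\}$), with distributional curl $\operatorname{curl}H^\#\in L^2_{loc}(\Omega_h^\#;\mathbb R^2)$, $\operatorname{curl}H\in L^2(\Omega_h;\mathbb R^2)$, where $(\operatorname{curl} H)_i=\partial_xH_{i2}-\partial_yH_{i1}$, such that $\operatorname{curl}H^\#=\sigma*\varrho_{r_0}$ in $\Omega_h^\#$ and the tangential trace satisfies $H^\#[\mathbf e_1]=e_0\mathbf e_1$ on $\{y=0\}$ (in the sense of Green's formula tested with functions in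 $C^\infty_c(\{y<h(x)\})$). \emph{Energy.} With $H_{sym}=(H+H^T)/2$ and $W(E)=\mu|E|^2+\frac\lambda2(\operatorname{tr}E)^2$, let $$F(h,\sigma,H)=\int_{\Omega_h}W(H_{sym})\,dz+\gamma\,\mathcal H^1(\Gamma_h)+2\gamma\,\mathcal H^1(\Sigma_h)\in[0,\infty].$$ \textbf{Theorem.} Let $(\bar h,\bar\sigma,\bar H)\in X(e_0;\mathbf B)$ with $|\Omega_{\bar h}|=d$ be a minimizer of $F$ among all $(h,\sigma,H)\in X(e_0;\mathbf B)$ with $|\Omega_h|=d$. If $\bar h^-$ is constant, then $\bar h$ has no vertical cuts: $\Sigma_{\bar h}=\emptyset$. -/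

import Mathlib

open MeasureTheory Set
open scoped ContDiff CompactlySupported

noncomputable section

namespace EpitaxialFilm

/-- The Euclidean plane; a point is `z = (x, y) = (z 0, z 1)`. -/
abbrev Plane : Type := EuclideanSpace ℝ (Fin 2)

/-- `2 × 2` real matrices. -/
abbrev Mat : Type := Matrix (Fin 2) (Fin 2) ℝ

/-- The vector `𝐞₁ = (1, 0)`. -/
def e₁ : Plane := EuclideanSpace.single 0 1

/-- The vector `𝐞₂ = (0, 1)`. -/
def e₂ : Plane := EuclideanSpace.single 1 1

/-! ### Profiles and their geometry -/

/-- The class `AP(0, ℓ)`: nonnegative, lower semicontinuous, `ℓ`-periodic profiles whose pointwise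
total variation over `(0, ℓ)` is finite. -/
structure AdmissibleProfile (ℓ : ℝ) (h : ℝ → ℝ) : Prop where
  nonneg : ∀ x, 0 ≤ h x
  lowerSemicontinuous : LowerSemicontinuous h
  periodic : Function.Periodic h ℓ
  boundedVariation : BoundedVariationOn h (Ioo 0 ℓ)

/-- `h⁻(x) = min {h(x+), h(x-)}`. -/
def lowerLim (h : ℝ → ℝ) (x : ℝ) : ℝ := min (Function.rightLim h x) (Function.leftLim h x)

/-- `h⁺(x) = max {h(x+), h(x-)}`. -/
def upperLim (h : ℝ → ℝ) (x : ℝ) : ℝ := max (Function.rightLim h x) (Function.leftLim h x)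

/-- The reference configuration `Ω_h` of the film (one period). -/
def film (ℓ : ℝ) (h : ℝ → ℝ) : Set Plane :=
  {z | z 0 ∈ Ico 0 ℓ ∧ 0 < z 1 ∧ z 1 < h (z 0)}

/-- The set `Ω_h^#`, the film repeated periodically. -/
def filmSharp (h : ℝ → ℝ) : Set Plane :=
  {z | 0 < z 1 ∧ z 1 < h (z 0)}

/-- The region lying strictly below the profile: `Ω_h^#`, the interface where `h > 0`, and the
half plane `y < 0`. It is open when `h` is lower semicontinuous. -/
def subgraph (h : ℝ → ℝ) : Set Plane := {z | z 1 < h (z 0)}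

/-- The (extended) graph `Γ_h`. -/
def graphSet (ℓ : ℝ) (h : ℝ → ℝ) : Set Plane :=
  {z | z 0 ∈ Ico 0 ℓ ∧ lowerLim h (z 0) ≤ z 1 ∧ z 1 ≤ upperLim h (z 0)}

/-- The set `Σ_h` of vertical cracks (vertical cuts). -/
def verticalCracks (ℓ : ℝ) (h : ℝ → ℝ) : Set Plane :=
  {z | z 0 ∈ Ico 0 ℓ ∧ h (z 0) < lowerLim h (z 0) ∧ h (z 0) ≤ z 1 ∧ z 1 ≤ lowerLim h (z 0)}

/-- The `ℓ`-periodic extension in the `x`-direction `H^#` of a field `H`, of which only the values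
on `0 ≤ x < ℓ` are used. -/
def periodicExt {α : Type*} (ℓ : ℝ) (H : Plane → α) (z : Plane) : α :=
  H (z - ((⌊z 0 / ℓ⌋ : ℝ) * ℓ) • e₁)

/-! ### Dislocation measures and their regularization -/

/-- A nonnegative radially symmetric `ϱ ∈ C_c^∞(B_1(0))` with unit integral. -/
structure Mollifier where
  toFun : Plane → ℝ
  smooth : ContDiff ℝ ∞ toFun
  tsupport_subset : tsupport toFun ⊆ Metric.ball 0 1
  nonneg : ∀ z, 0 ≤ toFun z
  radial : ∀ z w, ‖z‖ = ‖w‖ → toFun z = toFun w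
  integral_eq_one : ∫ z, toFun z = 1

/-- `ϱ_{r₀}(z) = ϱ(z / r₀) / r₀²`. -/
def Mollifier.scaled (ϱ : Mollifier) (r₀ : ℝ) (z : Plane) : ℝ :=
  1 / r₀ ^ 2 * ϱ.toFun (r₀⁻¹ • z)

theorem Mollifier.continuous_kernel (ϱ : Mollifier) (r₀ : ℝ) (w : Plane) :
    Continuous fun z => ϱ.scaled r₀ (w - z) := by
  have := ϱ.smooth.continuous
  unfold Mollifier.scaled
  fun_prop

theorem Mollifier.hasCompactSupport_kernel (ϱ : Mollifier) (r₀ : ℝ) (w : Plane) :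
    HasCompactSupport fun z => ϱ.scaled r₀ (w - z) := by
  rcases eq_or_ne r₀ 0 with rfl | hr
  · have : (fun z => ϱ.scaled 0 (w - z)) = 0 := by
      funext z
      simp [Mollifier.scaled]
    rw [this]
    exact HasCompactSupport.zero
  · refine HasCompactSupport.intro (isCompact_closedBall w |r₀|) fun z hz => ?_
    have h1 : r₀⁻¹ • (w - z) ∉ tsupport ϱ.toFun := by
      intro hmem
      apply hz
      have h2 := ϱ.tsupport_subset hmem
      rw [mem_ball_zero_iff, norm_smul, norm_inv, Real.norm_eq_abs,
        inv_mul_lt_iff₀ (abs_pos.mpr hr), mul_one] at h2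
      rw [Metric.mem_closedBall, dist_comm, dist_eq_norm]
      exact h2.le
    simp [Mollifier.scaled, image_eq_zero_of_notMem_tsupport h1]

/-- The test function `z ↦ ϱ_{r₀}(w - z)`. -/
def Mollifier.kernel (ϱ : Mollifier) (r₀ : ℝ) (w : Plane) : C_c(Plane, ℝ) where
  toFun z := ϱ.scaled r₀ (w - z)
  continuous_toFun := ϱ.continuous_kernel r₀ w
  hasCompactSupport' := ϱ.hasCompactSupport_kernel r₀ w

/-- `ℝ²`-valued Radon measures, given through their action `φ ↦ ∫ φ dσ` on `C_c`.
The only elements that are used are the dislocation measures below. -/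
abbrev RadonVec : Type := C_c(Plane, ℝ) → Plane

/-- `δ_z^# = ∑_{m ∈ ℤ} δ_{z + m ℓ 𝐞₁}`. -/
def periodicDirac (ℓ : ℝ) (z : Plane) : Measure Plane :=
  Measure.sum fun m : ℤ => Measure.dirac (z + ((m : ℝ) * ℓ) • e₁)

/-- The dislocation measure `∑ᵢ 𝐛ᵢ δ_{zᵢ}^#`. -/
def dislocationMeasure {k : ℕ} (ℓ : ℝ) (b z : Fin k → Plane) : RadonVec :=
  fun φ => ∑ i, (∫ w, φ w ∂(periodicDirac ℓ (z i))) • b i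

/-- The set `M_dis(Ω_h; 𝐁)`; the centers need not be distinct. -/
def dislocationMeasures {k : ℕ} (ℓ r₀ : ℝ) (b : Fin k → Plane) (h : ℝ → ℝ) : Set RadonVec :=
  {σ | ∃ z : Fin k → Plane, (∀ i, z i ∈ film ℓ h ∧ Metric.ball (z i) r₀ ⊆ filmSharp h) ∧
    σ = dislocationMeasure ℓ b z}

/-- The function `σ * ϱ_{r₀}`. -/
def regularized (ϱ : Mollifier) (r₀ : ℝ) (σ : RadonVec) (w : Plane) : Plane :=
  σ (ϱ.kernel r₀ w)

/-! ### Strain fields -/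

/-- `φ ∈ C_c^∞(U)`. -/
structure IsTest (U : Set Plane) (φ : Plane → ℝ) : Prop where
  smooth : ContDiff ℝ ∞ φ
  hasCompactSupport : HasCompactSupport φ
  tsupport_subset : tsupport φ ⊆ U

/-- `curl H = g` in the sense of distributions in the open set `U`, where
`(curl H)ᵢ = ∂ₓ Hᵢ₂ - ∂ᵧ Hᵢ₁` for the two rows of `H`. -/
def IsWeakCurl (U : Set Plane) (H : Plane → Mat) (g : Plane → Plane) : Prop :=
  ∀ φ : Plane → ℝ, IsTest U φ → ∀ i : Fin 2,
    ∫ z in U, g z i * φ z =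
      ∫ z in U, (H z i 0 * fderiv ℝ φ z e₂ - H z i 1 * fderiv ℝ φ z e₁)

/-- For a field `H` on `Ω_h^#` with `curl H = g`, the tangential trace `H[𝐞₁]` on the interface
`{y = 0}` equals the constant vector `t`. As usual the trace is defined by Green's formula, here
against test functions that need not vanish on the part of `{y = 0}` where `h > 0`. -/
def HasTangentialTrace (h : ℝ → ℝ) (H : Plane → Mat) (g : Plane → Plane) (t : Plane) : Prop :=
  ∀ φ : Plane → ℝ, IsTest (subgraph h) φ → ∀ i : Fin 2,
    ∫ z in filmSharp h, g z i * φ z =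
      (∫ z in filmSharp h, (H z i 0 * fderiv ℝ φ z e₂ - H z i 1 * fderiv ℝ φ z e₁))
        + ∫ x : ℝ, t i * φ !₂[x, 0]

/-- The space `𝐇_#(curl; Ω_h; 𝕄^{2×2})`. Local square integrability is understood in the periodic
film up to the interface `{y = 0}` (but away from the profile), so that a tangential trace
on the interface makes sense. -/
structure MemHcurl (ℓ : ℝ) (h : ℝ → ℝ) (H : Plane → Mat) : Prop where
  memLp_loc : ∀ K : Set Plane, IsCompact K → K ⊆ subgraph h → ∀ i j,
    MemLp (fun z => periodicExt ℓ H z i j) 2 (volume.restrict (K ∩ filmSharp h))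
  exists_curl : ∃ g : Plane → Plane, IsWeakCurl (filmSharp h) (periodicExt ℓ H) g ∧
    MemLp g 2 (volume.restrict (film ℓ h)) ∧
    ∀ K : Set Plane, IsCompact K → K ⊆ filmSharp h → MemLp g 2 (volume.restrict K)

/-- Membership `(h, σ, H) ∈ X(e₀; 𝐁)`. -/
structure Admissible {k : ℕ} (ℓ r₀ e₀ : ℝ) (ϱ : Mollifier) (b : Fin k → Plane)
    (h : ℝ → ℝ) (σ : RadonVec) (H : Plane → Mat) : Prop where
  profile : AdmissibleProfile ℓ h
  dislocation : σ ∈ dislocationMeasures ℓ r₀ b h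
  memHcurl : MemHcurl ℓ h H
  curl_eq : IsWeakCurl (filmSharp h) (periodicExt ℓ H) (regularized ϱ r₀ σ)
  trace_eq : HasTangentialTrace h (periodicExt ℓ H) (regularized ϱ r₀ σ) (e₀ • e₁)

/-! ### Energy and minimizers -/

/-- The symmetric part `(H + Hᵀ) / 2`. -/
def symPart (H : Mat) : Mat := (1 / 2 : ℝ) • (H + H.transpose)

/-- The elastic energy density `W(E) = μ |E|² + (λ / 2) (tr E)²`. -/
def elasticDensity (lam mu : ℝ) (E : Mat) : ℝ :=
  mu * (∑ i, ∑ j, E i j ^ 2) + lam / 2 * E.trace ^ 2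

open scoped MeasureTheory in
/-- The total energy `F(h, σ, H) ∈ [0, ∞]` (it depends on `σ` only through `H`). -/
def totalEnergy (ℓ lam mu γ : ℝ) (h : ℝ → ℝ) (H : Plane → Mat) : ENNReal :=
  (∫⁻ z in film ℓ h, ENNReal.ofReal (elasticDensity lam mu (symPart (H z))))
    + ENNReal.ofReal γ * μH[1] (graphSet ℓ h)
    + 2 * ENNReal.ofReal γ * μH[1] (verticalCracks ℓ h)

/-- `(h, σ, H)` minimizes `F` among all `(g, τ, K) ∈ X(e₀; 𝐁)` with `|Ω_g| = d`. -/
structure IsVolumeConstrainedMinimizer {k : ℕ} (ℓ r₀ e₀ lam mu γ d : ℝ) (ϱ : Mollifier)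
    (b : Fin k → Plane) (h : ℝ → ℝ) (σ : RadonVec) (H : Plane → Mat) : Prop where
  admissible : Admissible ℓ r₀ e₀ ϱ b h σ H
  volume_eq : volume (film ℓ h) = ENNReal.ofReal d
  le_energy : ∀ (g : ℝ → ℝ) (τ : RadonVec) (K : Plane → Mat),
    Admissible ℓ r₀ e₀ ϱ b g τ K → volume (film ℓ g) = ENNReal.ofReal d →
    totalEnergy ℓ lam mu γ h H ≤ totalEnergy ℓ lam mu γ g K

end EpitaxialFilm

end

open EpitaxialFilm

noncomputable section

namespace EpitaxialFilm

open Filter Topology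

/-! ### Functions of bounded variation -/

/-! A cut counts twice in the energy, once per side, so opening it slightly at the top is cheaper
than keeping it. Let `c` be the constant value of `h⁻`. Both one-sided limits of `h` are then `c`
everywhere, `h ≤ c`, and `h = c` almost everywhere. If there is a cut at `x₀`, remove from the film
a right triangle with vertical side of length `δ` along the top of the cut and hypotenuse of slope
one. This saves `2γδ` of cut energy. The new graph has a wall `δ` and a hypotenuse `√2 δ` in place
of a horizontal piece `δ`, so it costs only `√2 γδ` more, and the net gain `(2 - √2)γδ` is of first
order.

The lost area `δ²/2` is restored by lifting the whole film, dislocations included, by `t = δ²/(2ℓ)`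
and filling the gap with the constant field whose first column is `e₀𝐞₁`. The tangential traces
match, so no curl is created at the junction (`hasTangentialTrace_liftedField`), and the layer costs
only `O(δ²)`. For small `δ` the competitor beats the minimizer (`not_energy_le`).

Two points need care. The core disks must miss the notch: a disk of radius `r₀` below height `c`
that avoids the cut stays away from its upper end (`lt_notch_of_mem_ball`). Also, the minimal energy
must be finite for the comparison to be strict; a flat film with an explicit field shows this
(`admissible_primitiveField`). -/

theorem boundedVariationOn_of_edist_le {f g F : ℝ → ℝ} {s : Set ℝ}
    (hf : BoundedVariationOn f s) (hg : BoundedVariationOn g s)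
    (hF : ∀ x ∈ s, ∀ y ∈ s, edist (F x) (F y) ≤ edist (f x) (f y) + edist (g x) (g y)) :
    BoundedVariationOn F s := by
  refine ne_top_of_le_ne_top (ENNReal.add_ne_top.2 ⟨hf, hg⟩) (iSup_le ?_)
  rintro ⟨n, u, hu, us⟩
  calc ∑ i ∈ Finset.range n, edist (F (u (i + 1))) (F (u i))
      ≤ ∑ i ∈ Finset.range n,
          (edist (f (u (i + 1))) (f (u i)) + edist (g (u (i + 1))) (g (u i))) :=
        Finset.sum_le_sum fun i _ => hF _ (us _) _ (us _)
    _ ≤ _ := by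
        rw [Finset.sum_add_distrib]
        exact add_le_add (eVariationOn.sum_le hu us) (eVariationOn.sum_le hu us)

theorem boundedVariationOn_min {f g : ℝ → ℝ} {s : Set ℝ}
    (hf : BoundedVariationOn f s) (hg : BoundedVariationOn g s) :
    BoundedVariationOn (fun x => min (f x) (g x)) s := by
  refine boundedVariationOn_of_edist_le hf hg fun x _ y _ => ?_
  simp only [edist_dist, Real.dist_eq]
  rw [← ENNReal.ofReal_add (abs_nonneg _) (abs_nonneg _)]
  refine ENNReal.ofReal_le_ofReal ((abs_min_sub_min_le_max _ _ _ _).trans ?_)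
  exact max_le (le_add_of_nonneg_right (abs_nonneg _)) (le_add_of_nonneg_left (abs_nonneg _))

theorem boundedVariationOn_const_add {f : ℝ → ℝ} {s : Set ℝ} (t : ℝ)
    (hf : BoundedVariationOn f s) : BoundedVariationOn (fun x => t + f x) s :=
  boundedVariationOn_of_edist_le hf hf fun x _ y _ => by
    rw [edist_add_left]; exact le_self_add

/-! ### One-sided limits of profiles with constant `h⁻`. -/

namespace AdmissibleProfile

variable {ℓ : ℝ} {h : ℝ → ℝ}

/-- Bounded variation is known only on the open period, so `x` is first moved into `[0, ℓ)`, where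
right neighbourhoods lie in `(0, ℓ)`. For left limits the representative must lie in `(0, ℓ]`
instead. -/
theorem exists_tendsto_right (hℓ : 0 < ℓ) (hh : AdmissibleProfile ℓ h) (x : ℝ) :
    ∃ l, Tendsto h (𝓝[>] x) (𝓝 l) := by
  have hx := toIcoMod_mem_Ico hℓ 0 x
  obtain ⟨l, hl⟩ := hh.boundedVariation.exists_tendsto_right (toIcoMod hℓ 0 x)
  refine ⟨l, ?_⟩
  have hset : Ioo 0 ℓ ∩ Ioi (toIcoMod hℓ 0 x) = Ioo (toIcoMod hℓ 0 x) ℓ := by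
    ext y; simp only [mem_inter_iff, mem_Ioo, mem_Ioi, mem_Ico] at hx ⊢; grind
  rw [hset, nhdsWithin_Ioo_eq_nhdsGT (by simpa using hx.2)] at hl
  have hsub : Tendsto (fun y => y - toIcoDiv hℓ 0 x • ℓ) (𝓝[>] x) (𝓝[>] (toIcoMod hℓ 0 x)) := by
    refine tendsto_nhdsWithin_of_tendsto_nhds_of_eventually_within _ ?_ ?_
    · exact ((continuous_id.sub continuous_const).tendsto x).mono_left nhdsWithin_le_nhds
    · filter_upwards [self_mem_nhdsWithin] with y hy
      exact sub_lt_sub_right (mem_Ioi.1 hy) _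
  refine (hl.comp hsub).congr fun y => ?_
  exact hh.periodic.sub_zsmul_eq _

theorem exists_tendsto_left (hℓ : 0 < ℓ) (hh : AdmissibleProfile ℓ h) (x : ℝ) :
    ∃ l, Tendsto h (𝓝[<] x) (𝓝 l) := by
  have hx := toIocMod_mem_Ioc hℓ 0 x
  obtain ⟨l, hl⟩ := hh.boundedVariation.exists_tendsto_left (toIocMod hℓ 0 x)
  refine ⟨l, ?_⟩
  have hset : Ioo 0 ℓ ∩ Iio (toIocMod hℓ 0 x) = Ioo 0 (toIocMod hℓ 0 x) := by
    ext y; simp only [mem_inter_iff, mem_Ioo, mem_Iio, mem_Ioc] at hx ⊢; grind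
  rw [hset, nhdsWithin_Ioo_eq_nhdsLT (by simpa using hx.1)] at hl
  have hsub : Tendsto (fun y => y - toIocDiv hℓ 0 x • ℓ) (𝓝[<] x) (𝓝[<] (toIocMod hℓ 0 x)) := by
    refine tendsto_nhdsWithin_of_tendsto_nhds_of_eventually_within _ ?_ ?_
    · exact ((continuous_id.sub continuous_const).tendsto x).mono_left nhdsWithin_le_nhds
    · filter_upwards [self_mem_nhdsWithin] with y hy
      exact sub_lt_sub_right (mem_Iio.1 hy) _
  refine (hl.comp hsub).congr fun y => ?_
  exact hh.periodic.sub_zsmul_eq _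

/-- A one-sided limit above `c` would keep `h` above some `m > c` on a whole open one-sided
neighbourhood, and at any point of it both limits would be at least `m`, against `h⁻ = c`. So the
larger one-sided limit is `c` as well. -/
theorem tendsto_of_lowerLim_eq (hℓ : 0 < ℓ) (hh : AdmissibleProfile ℓ h) {c : ℝ}
    (hc : ∀ x, lowerLim h x = c) (x : ℝ) : Tendsto h (𝓝[≠] x) (𝓝 c) := by
  have key : ∀ (x L : ℝ) (S : ℝ → Set ℝ), (∀ y, (𝓝[S y] y).NeBot) → IsOpen (S x) →
      Tendsto h (𝓝[S x] x) (𝓝 L) → L ≤ c := by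
    intro x L S hne hopen hL
    by_contra! hcL
    obtain ⟨m, hcm, hmL⟩ := exists_between hcL
    have hev : ∀ᶠ y in 𝓝[S x] x, m < h y := hL.eventually (lt_mem_nhds hmL)
    have hev2 : ∀ᶠ y in 𝓝[S x] x, ∀ᶠ z in 𝓝 y, m < h z := by
      have := eventually_eventually_nhdsWithin.2 hev
      filter_upwards [this, self_mem_nhdsWithin] with y hy hyS
      rwa [hopen.nhdsWithin_eq hyS] at hy
    obtain ⟨y, hy⟩ := hev2.exists
    obtain ⟨R, hR⟩ := hh.exists_tendsto_right hℓ y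
    obtain ⟨L', hL'⟩ := hh.exists_tendsto_left hℓ y
    have h1 : m ≤ R := ge_of_tendsto hR ((hy.filter_mono nhdsWithin_le_nhds).mono fun _ => le_of_lt)
    have h2 : m ≤ L' :=
      ge_of_tendsto hL' ((hy.filter_mono nhdsWithin_le_nhds).mono fun _ => le_of_lt)
    have h3 := hc y
    rw [lowerLim, rightLim_eq_of_tendsto hR, leftLim_eq_of_tendsto hL'] at h3
    exact absurd (le_min h1 h2) (by rw [h3]; exact not_le.2 hcm)
  obtain ⟨R, hR⟩ := hh.exists_tendsto_right hℓ x
  obtain ⟨L, hL⟩ := hh.exists_tendsto_left hℓ x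
  have h3 := hc x
  rw [lowerLim, rightLim_eq_of_tendsto hR, leftLim_eq_of_tendsto hL] at h3
  have hR' := key x R Ioi (fun _ => inferInstance) isOpen_Ioi hR
  have hL' := key x L Iio (fun _ => inferInstance) isOpen_Iio hL
  have hRc : R = c := le_antisymm hR' (h3 ▸ min_le_left _ _)
  have hLc : L = c := le_antisymm hL' (h3 ▸ min_le_right _ _)
  rw [← Iio_union_Ioi, nhdsWithin_union, tendsto_sup]
  exact ⟨hLc ▸ hL, hRc ▸ hR⟩

theorem le_of_tendsto_punctured (hh : AdmissibleProfile ℓ h) {c x : ℝ}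
    (hc : Tendsto h (𝓝[≠] x) (𝓝 c)) : h x ≤ c := by
  by_contra! hlt
  obtain ⟨m, hm1, hm2⟩ := exists_between hlt
  have h1 := (hh.lowerSemicontinuous x m hm2).filter_mono
    (nhdsWithin_le_nhds : 𝓝[≠] x ≤ 𝓝 x)
  have : m ≤ c := ge_of_tendsto hc (h1.mono fun _ => le_of_lt)
  linarith

/-- A function of bounded variation is differentiable, hence continuous, almost everywhere, and at a
continuity point the value is the punctured limit. -/
theorem ae_eq_of_tendsto_punctured (hh : AdmissibleProfile ℓ h) {c : ℝ}
    (hc : ∀ x, Tendsto h (𝓝[≠] x) (𝓝 c)) : ∀ᵐ x, x ∈ Ico 0 ℓ → h x = c := by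
  have h0 : ∀ᵐ x : ℝ, x ≠ 0 := compl_mem_ae_iff.2 (measure_singleton 0)
  filter_upwards [hh.boundedVariation.locallyBoundedVariationOn.ae_differentiableWithinAt_of_mem,
    h0] with x hx hx0 hmem
  have hmem' : x ∈ Ioo 0 ℓ := ⟨lt_of_le_of_ne hmem.1 (Ne.symm hx0), hmem.2⟩
  have hcont : ContinuousAt h x :=
    (hx hmem').continuousWithinAt.continuousAt (isOpen_Ioo.mem_nhds hmem')
  exact tendsto_nhds_unique (hcont.tendsto.mono_left nhdsWithin_le_nhds) (hc x)

end AdmissibleProfile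

/-! ### The notched profile -/

/-- The `ℓ`-periodic profile of height `c` with a triangular notch of depth `δ` on the right
of `x₀`. -/
def notch (ℓ c δ x₀ x : ℝ) : ℝ := c - δ + min δ (ℓ * Int.fract ((x - x₀) / ℓ))

section Notch

variable {ℓ c δ x₀ : ℝ}

theorem notch_le (x : ℝ) : notch ℓ c δ x₀ x ≤ c := by
  have := min_le_left δ (ℓ * Int.fract ((x - x₀) / ℓ))
  unfold notch; linarith

theorem le_notch (hℓ : 0 < ℓ) (hδ : 0 ≤ δ) (x : ℝ) : c - δ ≤ notch ℓ c δ x₀ x := by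
  have := le_min hδ (mul_nonneg hℓ.le (Int.fract_nonneg ((x - x₀) / ℓ)))
  unfold notch; linarith

theorem notch_periodic (hℓ : 0 < ℓ) : Function.Periodic (notch ℓ c δ x₀) ℓ := by
  intro x
  unfold notch
  rw [show (x + ℓ - x₀) / ℓ = (x - x₀) / ℓ + 1 by field_simp; ring, Int.fract_add_one]

theorem notch_self (hδ : 0 ≤ δ) : notch ℓ c δ x₀ x₀ = c - δ := by
  simp [notch, hδ]

theorem notch_of_mem (hx₀ : 0 ≤ x₀) {x : ℝ} (hx : x ∈ Ico 0 ℓ) :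
    x₀ ≤ x → notch ℓ c δ x₀ x = c - δ + min δ (x - x₀) := by
  intro h
  have hℓ : 0 < ℓ := hx.1.trans_lt hx.2
  have : Int.fract ((x - x₀) / ℓ) = (x - x₀) / ℓ := by
    rw [Int.fract_eq_self]
    exact ⟨div_nonneg (by linarith) hℓ.le, (div_lt_one hℓ).2 (by linarith [hx.2])⟩
  rw [notch, this, mul_div_cancel₀ _ hℓ.ne']

theorem notch_of_lt (hxδ : x₀ + δ < ℓ) {x : ℝ} (hx : x ∈ Ico 0 ℓ) (h : x < x₀) (hx₀ : x₀ < ℓ) :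
    notch ℓ c δ x₀ x = c := by
  have hℓ : 0 < ℓ := hx.1.trans_lt hx.2
  have : Int.fract ((x - x₀) / ℓ) = (x - x₀) / ℓ + 1 := by
    rw [Int.fract_eq_iff]
    refine ⟨?_, ?_, -1, by push_cast; ring⟩
    · have : -1 ≤ (x - x₀) / ℓ := by rw [le_div_iff₀ hℓ]; linarith [hx.1]
      linarith
    · have : (x - x₀) / ℓ < 0 := div_neg_of_neg_of_pos (by linarith) hℓ
      linarith
  -- The notch of the previous period ends at `x₀ + δ - ℓ < 0`, so it does not reach `[0, x₀)`.
  rw [notch, this, mul_add, mul_div_cancel₀ _ hℓ.ne', min_eq_left (by linarith [hx.1])]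
  ring

theorem exists_int_of_notch_lt (hℓ : 0 < ℓ) {x : ℝ} (h : notch ℓ c δ x₀ x < c) :
    ∃ m : ℤ, x₀ + m * ℓ ≤ x ∧ x < x₀ + m * ℓ + δ := by
  refine ⟨⌊(x - x₀) / ℓ⌋, ?_, ?_⟩
  · have := (le_div_iff₀ hℓ).1 (Int.floor_le ((x - x₀) / ℓ)); linarith
  · have h1 : min δ (ℓ * Int.fract ((x - x₀) / ℓ)) < δ := by unfold notch at h; linarith
    have h2 := (min_lt_iff.1 h1).resolve_left (lt_irrefl _)
    rw [Int.fract, mul_sub, mul_div_cancel₀ _ hℓ.ne'] at h2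
    linarith

theorem tendsto_notch_right (hℓ : 0 < ℓ) (x : ℝ) :
    Tendsto (notch ℓ c δ x₀) (𝓝[>] x) (𝓝 (notch ℓ c δ x₀ x)) := by
  have h1 : Tendsto (fun y => (y - x₀) / ℓ) (𝓝[>] x) (𝓝[≥] ((x - x₀) / ℓ)) := by
    refine tendsto_nhdsWithin_of_tendsto_nhds_of_eventually_within _ ?_ ?_
    · exact (Continuous.tendsto (by fun_prop) x).mono_left nhdsWithin_le_nhds
    · filter_upwards [self_mem_nhdsWithin] with y hy
      have := mem_Ioi.1 hy
      rw [mem_Ici]; gcongr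
  have h2 : Tendsto Int.fract (𝓝[≥] ((x - x₀) / ℓ)) (𝓝 (Int.fract ((x - x₀) / ℓ))) := by
    by_cases hz : ∃ n : ℤ, (n : ℝ) = (x - x₀) / ℓ
    · obtain ⟨n, hn⟩ := hz
      rw [← hn, Int.fract_intCast]
      exact tendsto_fract_right' n
    · refine (continuousAt_fract ?_).tendsto.mono_left nhdsWithin_le_nhds
      intro hh; exact hz ⟨_, hh.symm⟩
  have := h2.comp h1
  exact tendsto_const_nhds.add (tendsto_const_nhds.min (tendsto_const_nhds.mul this))

theorem continuousAt_notch (hℓ : 0 < ℓ) {x : ℝ} (hx : ∀ m : ℤ, x ≠ x₀ + m * ℓ) :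
    ContinuousAt (notch ℓ c δ x₀) x := by
  have h2 : ContinuousAt (Int.fract : ℝ → ℝ) ((x - x₀) / ℓ) := by
    refine continuousAt_fract ?_
    intro h
    apply hx ⌊(x - x₀) / ℓ⌋
    rw [← h]; field_simp; ring
  have h3 : ContinuousAt (fun y => Int.fract ((y - x₀) / ℓ)) x :=
    ContinuousAt.comp (f := fun y => (y - x₀) / ℓ) h2 (by fun_prop)
  unfold notch
  fun_prop

/-- This is the vertical wall of the notch: the fractional part tends to `1` from the left and `min
δ ℓ = δ`. -/
theorem tendsto_notch_left_lattice (hℓ : 0 < ℓ) (hδ : δ < ℓ) (m : ℤ) :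
    Tendsto (notch ℓ c δ x₀) (𝓝[<] (x₀ + m * ℓ)) (𝓝 c) := by
  have h1 : Tendsto (fun y => (y - x₀) / ℓ) (𝓝[<] (x₀ + m * ℓ)) (𝓝[<] (m : ℝ)) := by
    refine tendsto_nhdsWithin_of_tendsto_nhds_of_eventually_within _ ?_ ?_
    · have : Tendsto (fun y => (y - x₀) / ℓ) (𝓝 (x₀ + m * ℓ)) (𝓝 ((x₀ + m * ℓ - x₀) / ℓ)) :=
        Continuous.tendsto (by fun_prop) _
      rw [show (x₀ + m * ℓ - x₀) / ℓ = m by field_simp; ring] at this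
      exact this.mono_left nhdsWithin_le_nhds
    · filter_upwards [self_mem_nhdsWithin] with y hy
      have := mem_Iio.1 hy
      rw [mem_Iio, div_lt_iff₀ hℓ]; linarith
  have h2 := (tendsto_fract_left' m).comp h1
  have h3 : Tendsto (notch ℓ c δ x₀) (𝓝[<] (x₀ + m * ℓ)) (𝓝 (c - δ + min δ (ℓ * 1))) :=
    tendsto_const_nhds.add (tendsto_const_nhds.min (tendsto_const_nhds.mul h2))
  rw [mul_one, min_eq_left hδ.le] at h3
  simpa using h3

theorem lowerSemicontinuous_notch (hℓ : 0 < ℓ) (hδ : 0 ≤ δ) :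
    LowerSemicontinuous (notch ℓ c δ x₀) := by
  intro x
  by_cases hx : ∀ m : ℤ, x ≠ x₀ + m * ℓ
  · exact (continuousAt_notch hℓ hx).lowerSemicontinuousAt
  · push Not at hx
    obtain ⟨m, rfl⟩ := hx
    intro y hy
    have : notch ℓ c δ x₀ (x₀ + m * ℓ) = c - δ := by
      rw [← notch_self (ℓ := ℓ) (c := c) (x₀ := x₀) hδ]
      exact (notch_periodic hℓ).int_mul m x₀
    rw [this] at hy
    exact Eventually.of_forall fun z => hy.trans_le (le_notch hℓ hδ z)

/-- On one period the notch is a constant minus a monotone jump plus a monotone ramp. -/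
theorem boundedVariationOn_notch (hδ : 0 ≤ δ) (hx₀ : x₀ ∈ Ico 0 ℓ) (hxδ : x₀ + δ < ℓ) :
    BoundedVariationOn (notch ℓ c δ x₀) (Ioo 0 ℓ) := by
  have hf : BoundedVariationOn (fun x => if x < x₀ then 0 else δ) (Ioo 0 ℓ) := by
    refine MonotoneOn.boundedVariationOn (C := δ) ?_ ?_
    · intro x _ y _ hxy
      dsimp only
      split_ifs <;> linarith
    · intro x _
      split_ifs <;> simp [abs_of_nonneg, hδ]
  have hg : BoundedVariationOn (fun x => if x < x₀ then 0 else min δ (x - x₀)) (Ioo 0 ℓ) := by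
    refine MonotoneOn.boundedVariationOn (C := δ) ?_ ?_
    · intro x _ y _ hxy
      dsimp only
      split_ifs
      · exact le_rfl
      · exact le_min hδ (by linarith)
      · linarith
      · exact min_le_min_left _ (by linarith)
    · intro x _
      split_ifs
      · simpa using hδ
      · rw [abs_of_nonneg (le_min hδ (by linarith))]
        exact min_le_left _ _
  refine boundedVariationOn_of_edist_le hf hg fun x hx y hy => ?_
  have key : ∀ x ∈ Ioo 0 ℓ, notch ℓ c δ x₀ x =
      c - (if x < x₀ then 0 else δ) + (if x < x₀ then 0 else min δ (x - x₀)) := by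
    intro x hx
    split_ifs with h
    · rw [notch_of_lt hxδ ⟨hx.1.le, hx.2⟩ h hx₀.2]; ring
    · rw [notch_of_mem hx₀.1 ⟨hx.1.le, hx.2⟩ (not_lt.1 h)]
  rw [key x hx, key y hy]
  simp only [edist_dist, Real.dist_eq]
  rw [← ENNReal.ofReal_add (abs_nonneg _) (abs_nonneg _)]
  apply ENNReal.ofReal_le_ofReal
  generalize (if x < x₀ then 0 else δ) = a
  generalize (if y < x₀ then 0 else δ) = b
  generalize (if x < x₀ then 0 else min δ (x - x₀)) = u
  generalize (if y < x₀ then 0 else min δ (y - x₀)) = v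
  rw [show c - a + u - (c - b + v) = (b - a) + (u - v) by ring, abs_sub_comm a b]
  exact abs_add_le _ _

end Notch

/-- The profile `h` cut along the notch and lifted by `t`. -/
def notchedProfile (ℓ c δ x₀ t : ℝ) (h : ℝ → ℝ) (x : ℝ) : ℝ := t + min (h x) (notch ℓ c δ x₀ x)

section NotchedProfile

variable {ℓ c δ x₀ t : ℝ} {h : ℝ → ℝ}

theorem notchedProfile_le (x : ℝ) : notchedProfile ℓ c δ x₀ t h x ≤ t + h x :=
  add_le_add_right (min_le_left _ _) t

theorem admissibleProfile_notchedProfile (hℓ : 0 < ℓ) (hh : AdmissibleProfile ℓ h) (ht : 0 ≤ t)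
    (hδ : 0 ≤ δ) (hδc : δ ≤ c) (hx₀ : x₀ ∈ Ico 0 ℓ) (hxδ : x₀ + δ < ℓ) :
    AdmissibleProfile ℓ (notchedProfile ℓ c δ x₀ t h) where
  nonneg x := add_nonneg ht
    (le_min (hh.nonneg x) ((sub_nonneg.2 hδc).trans (le_notch hℓ hδ x)))
  lowerSemicontinuous := by
    intro x y hy
    have h1 : y - t < min (h x) (notch ℓ c δ x₀ x) := by unfold notchedProfile at hy; linarith
    filter_upwards [hh.lowerSemicontinuous x _ (lt_min_iff.1 h1).1,
      lowerSemicontinuous_notch hℓ hδ x _ (lt_min_iff.1 h1).2] with z hz1 hz2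
    have := lt_min hz1 hz2
    unfold notchedProfile; linarith
  periodic x := by
    unfold notchedProfile; rw [hh.periodic x, notch_periodic hℓ x]
  boundedVariation := boundedVariationOn_const_add t
    (boundedVariationOn_min hh.boundedVariation (boundedVariationOn_notch hδ hx₀ hxδ))

theorem rightLim_notchedProfile (hℓ : 0 < ℓ) (hc : ∀ x, Tendsto h (𝓝[≠] x) (𝓝 c)) (x : ℝ) :
    Function.rightLim (notchedProfile ℓ c δ x₀ t h) x = t + notch ℓ c δ x₀ x := by
  apply rightLim_eq_of_tendsto
  have h1 := (hc x).mono_left (nhdsGT_le_nhdsNE x)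
  have := (tendsto_const_nhds (x := t)).add
    (h1.min (tendsto_notch_right (c := c) (δ := δ) (x₀ := x₀) hℓ x))
  rwa [min_eq_right (notch_le x)] at this

theorem leftLim_notchedProfile (hℓ : 0 < ℓ) (hc : ∀ x, Tendsto h (𝓝[≠] x) (𝓝 c)) {x : ℝ}
    (hx : ∀ m : ℤ, x ≠ x₀ + m * ℓ) :
    Function.leftLim (notchedProfile ℓ c δ x₀ t h) x = t + notch ℓ c δ x₀ x := by
  apply leftLim_eq_of_tendsto
  have h1 := (hc x).mono_left (nhdsLT_le_nhdsNE x)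
  have := (tendsto_const_nhds (x := t)).add
    (h1.min ((continuousAt_notch (c := c) (δ := δ) hℓ hx).tendsto.mono_left nhdsWithin_le_nhds))
  rwa [min_eq_right (notch_le x)] at this

theorem leftLim_notchedProfile_lattice (hℓ : 0 < ℓ) (hδ : δ < ℓ)
    (hc : ∀ x, Tendsto h (𝓝[≠] x) (𝓝 c)) (m : ℤ) :
    Function.leftLim (notchedProfile ℓ c δ x₀ t h) (x₀ + m * ℓ) = t + c := by
  apply leftLim_eq_of_tendsto
  have h1 := (hc (x₀ + m * ℓ)).mono_left (nhdsLT_le_nhdsNE _)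
  have := (tendsto_const_nhds (x := t)).add
    (h1.min (tendsto_notch_left_lattice (c := c) (x₀ := x₀) hℓ hδ m))
  rwa [min_self] at this

/-- Punctured limits do not see the isolated dips of `h`; only the notch, which lies below `c`,
remains. -/
theorem lowerLim_notchedProfile (hℓ : 0 < ℓ) (hδ : δ < ℓ)
    (hc : ∀ x, Tendsto h (𝓝[≠] x) (𝓝 c)) (x : ℝ) :
    lowerLim (notchedProfile ℓ c δ x₀ t h) x = t + notch ℓ c δ x₀ x := by
  rw [lowerLim, rightLim_notchedProfile hℓ hc]
  by_cases hx : ∀ m : ℤ, x ≠ x₀ + m * ℓ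
  · rw [leftLim_notchedProfile hℓ hc hx, min_self]
  · push Not at hx
    obtain ⟨m, rfl⟩ := hx
    rw [leftLim_notchedProfile_lattice hℓ hδ hc, min_eq_left]
    exact add_le_add_right (notch_le _) t

theorem upperLim_notchedProfile (hℓ : 0 < ℓ) (hc : ∀ x, Tendsto h (𝓝[≠] x) (𝓝 c)) {x : ℝ}
    (hx : x ∈ Ico 0 ℓ) (hx₀ : x₀ ∈ Ico 0 ℓ) (hne : x ≠ x₀) :
    upperLim (notchedProfile ℓ c δ x₀ t h) x = t + notch ℓ c δ x₀ x := by
  rw [upperLim, rightLim_notchedProfile hℓ hc, leftLim_notchedProfile hℓ hc, max_self]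
  intro m hm
  have h1 : (m : ℝ) < 1 := by
    by_contra! h
    nlinarith [hx.2, hx₀.1]
  have h2 : (-1 : ℝ) < m := by
    by_contra! h
    nlinarith [hx.1, hx₀.2]
  have : m = 0 := by
    have h1' : m < 1 := by exact_mod_cast h1
    have h2' : -1 < m := by exact_mod_cast h2
    omega
  subst this
  simp at hm
  exact hne hm

theorem upperLim_notchedProfile_self (hℓ : 0 < ℓ) (hδ : δ < ℓ)
    (hc : ∀ x, Tendsto h (𝓝[≠] x) (𝓝 c)) :
    upperLim (notchedProfile ℓ c δ x₀ t h) x₀ = t + c := by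
  have := leftLim_notchedProfile_lattice (t := t) (x₀ := x₀) hℓ hδ hc 0
  simp only [Int.cast_zero, zero_mul, add_zero] at this
  rw [upperLim, rightLim_notchedProfile hℓ hc, this, max_eq_right]
  exact add_le_add_right (notch_le _) t

end NotchedProfile

/-! ### Coordinates, areas and lengths -/

/-- The identification of the plane with `ℝ × ℝ`. -/
def planeEquiv : Plane ≃ᵐ ℝ × ℝ :=
  (MeasurableEquiv.toLp 2 (Fin 2 → ℝ)).symm.trans MeasurableEquiv.finTwoArrow

theorem planeEquiv_apply (z : Plane) : planeEquiv z = (z 0, z 1) := rfl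

theorem measurePreserving_planeEquiv : MeasurePreserving planeEquiv volume volume :=
  (EuclideanSpace.volume_preserving_symm_measurableEquiv_toLp (Fin 2)).trans
    (volume_preserving_finTwoArrow ℝ)

theorem eta_plane (z : Plane) : !₂[z 0, z 1] = z := by
  ext i; fin_cases i <;> rfl

theorem continuous_mkPlane {X : Type*} [TopologicalSpace X] {f g : X → ℝ} (hf : Continuous f)
    (hg : Continuous g) : Continuous fun x => (!₂[f x, g x] : Plane) := by
  refine (PiLp.continuous_toLp 2 _).comp (continuous_pi fun i => ?_)
  fin_cases i
  · exact hf
  · exact hg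

@[simp] theorem add_smul_e₂_zero (z : Plane) (t : ℝ) : (z + t • e₂) 0 = z 0 := by
  simp [e₂]

@[simp] theorem add_smul_e₂_one (z : Plane) (t : ℝ) : (z + t • e₂) 1 = z 1 + t := by
  simp [e₂]

@[simp] theorem sub_smul_e₂_zero (z : Plane) (t : ℝ) : (z - t • e₂) 0 = z 0 := by
  simp [e₂]

@[simp] theorem sub_smul_e₂_one (z : Plane) (t : ℝ) : (z - t • e₂) 1 = z 1 - t := by
  simp [e₂]

@[simp] theorem add_smul_e₁_zero (z : Plane) (t : ℝ) : (z + t • e₁) 0 = z 0 + t := by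
  simp [e₁]

@[simp] theorem add_smul_e₁_one (z : Plane) (t : ℝ) : (z + t • e₁) 1 = z 1 := by
  simp [e₁]

@[simp] theorem sub_smul_e₁_zero (z : Plane) (t : ℝ) : (z - t • e₁) 0 = z 0 - t := by
  simp [e₁]

@[simp] theorem sub_smul_e₁_one (z : Plane) (t : ℝ) : (z - t • e₁) 1 = z 1 := by
  simp [e₁]

theorem volume_film (ℓ : ℝ) {h : ℝ → ℝ} (hh : Measurable h) :
    volume (film ℓ h) = ∫⁻ x in Ico 0 ℓ, ENNReal.ofReal (h x) := by
  have : film ℓ h = planeEquiv ⁻¹' (regionBetween (fun _ => 0) h (Ico 0 ℓ)) := by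
    ext z
    simp only [film, regionBetween, mem_preimage, planeEquiv_apply, mem_ofPred_eq, mem_Ioo]
  rw [this, measurePreserving_planeEquiv.measure_preimage_equiv, Measure.volume_eq_prod,
    volume_regionBetween_eq_lintegral' measurable_const hh measurableSet_Ico]
  simp

theorem measurableSet_film (ℓ : ℝ) {h : ℝ → ℝ} (hh : Measurable h) :
    MeasurableSet (film ℓ h) := by
  have : film ℓ h = planeEquiv ⁻¹' (regionBetween (fun _ => 0) h (Ico 0 ℓ)) := by
    ext z
    simp only [film, regionBetween, mem_preimage, planeEquiv_apply, mem_ofPred_eq, mem_Ioo]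
  rw [this]
  exact planeEquiv.measurable (measurableSet_regionBetween measurable_const hh measurableSet_Ico)

theorem isOpen_subgraph {h : ℝ → ℝ} (hh : LowerSemicontinuous h) : IsOpen (subgraph h) := by
  rw [isOpen_iff_mem_nhds]
  intro z hz
  obtain ⟨m, hm1, hm2⟩ := exists_between (show z 1 < h (z 0) from hz)
  have h0 : Continuous fun w : Plane => w 0 := by fun_prop
  have h1 : Continuous fun w : Plane => w 1 := by fun_prop
  filter_upwards [h0.tendsto z (hh (z 0) m hm2), h1.tendsto z (gt_mem_nhds hm1)] with w hw1 hw2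
  exact lt_trans (mem_Iio.1 hw2) (show m < h (w 0) from hw1)

theorem isOpen_filmSharp {h : ℝ → ℝ} (hh : LowerSemicontinuous h) : IsOpen (filmSharp h) :=
  (isOpen_lt continuous_const (by fun_prop : Continuous fun w : Plane => w 1)).inter
    (isOpen_subgraph hh)

theorem filmSharp_subset_subgraph (h : ℝ → ℝ) : filmSharp h ⊆ subgraph h := fun _ hz => hz.2

theorem volume_film_const {ℓ c : ℝ} (hc : 0 ≤ c) :
    volume (film ℓ fun _ => c) = ENNReal.ofReal (c * ℓ) := by
  rw [volume_film ℓ measurable_const]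
  simp [ENNReal.ofReal_mul hc]

theorem volume_film_of_ae_eq {ℓ c : ℝ} {h : ℝ → ℝ} (hc : 0 ≤ c) (hh : Measurable h)
    (hae : ∀ᵐ x, x ∈ Ico 0 ℓ → h x = c) : volume (film ℓ h) = ENNReal.ofReal (c * ℓ) := by
  rw [volume_film ℓ hh, ← volume_film_const hc, volume_film ℓ measurable_const]
  refine setLIntegral_congr_fun_ae measurableSet_Ico ?_
  filter_upwards [hae] with x hx hmem
  rw [hx hmem]

theorem volume_film_notchedProfile {ℓ c δ x₀ t : ℝ} {h : ℝ → ℝ} (hℓ : 0 < ℓ) (ht : 0 ≤ t)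
    (hδ : 0 ≤ δ) (hδc : δ ≤ c) (hx₀ : x₀ ∈ Ico 0 ℓ) (hxδ : x₀ + δ < ℓ)
    (hh : AdmissibleProfile ℓ h) (hae : ∀ᵐ x, x ∈ Ico 0 ℓ → h x = c) :
    volume (film ℓ (notchedProfile ℓ c δ x₀ t h)) =
      ENNReal.ofReal ((t + c) * ℓ - δ ^ 2 / 2) := by
  have hm := (admissibleProfile_notchedProfile hℓ hh ht hδ hδc hx₀ hxδ).lowerSemicontinuous.measurable
  -- The depth of the notch below the flat level, except at the null point `x₀`. Its integral is the
  -- area `δ ^ 2 / 2` of the triangle.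
  set f : ℝ → ℝ := (Ioc x₀ (x₀ + δ)).indicator fun x => δ - (x - x₀) with hf
  have hsub : Ioc x₀ (x₀ + δ) ⊆ Ico 0 ℓ := fun x hx =>
    ⟨hx₀.1.trans hx.1.le, hx.2.trans_lt hxδ⟩
  have hne : ∀ᵐ x : ℝ, x ≠ x₀ := compl_mem_ae_iff.2 (measure_singleton x₀)
  have hint : IntegrableOn (fun x => δ - (x - x₀)) (Ioc x₀ (x₀ + δ)) :=
    (Continuous.integrableOn_Icc (by fun_prop)).mono_set Ioc_subset_Icc_self
  have hfint : IntegrableOn f (Ico 0 ℓ) := (hint.integrable_indicator measurableSet_Ioc).integrableOn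
  have hconst : IntegrableOn (fun _ : ℝ => t + c) (Ico 0 ℓ) := integrableOn_const (by simp)
  have hval : ∫ x in Ico 0 ℓ, (t + c - f x) = (t + c) * ℓ - δ ^ 2 / 2 := by
    rw [integral_sub hconst hfint, setIntegral_const, hf,
      setIntegral_indicator measurableSet_Ioc, inter_eq_right.2 hsub,
      ← intervalIntegral.integral_of_le (by linarith)]
    have : ∫ x in x₀..(x₀ + δ), (δ - (x - x₀)) = δ ^ 2 / 2 := by
      rw [intervalIntegral.integral_eq_sub_of_hasDerivAt
        (f := fun x => δ * x - (x - x₀) ^ 2 / 2) (f' := fun x => δ - (x - x₀))]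
      · ring
      · intro x _
        have h1 := (((hasDerivAt_id x).sub_const x₀).pow 2).div_const 2
        have h2 := ((hasDerivAt_id x).const_mul δ).sub h1
        convert! h2 using 1
        simp
      · exact Continuous.intervalIntegrable (by fun_prop) _ _
    rw [this]
    simp [hℓ.le, mul_comm]
  have hpos : ∀ x, 0 ≤ t + c - f x := by
    intro x
    rw [hf, indicator]
    split_ifs with hx
    · have := hx.1; linarith
    · linarith
  rw [volume_film ℓ hm, ← hval,
    ofReal_integral_eq_lintegral_ofReal (f := fun x => t + c - f x) (hconst.sub hfint)
    (Eventually.of_forall hpos)]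
  refine setLIntegral_congr_fun_ae measurableSet_Ico ?_
  filter_upwards [hae, hne] with x hx hxne hmem
  rw [notchedProfile, hx hmem, min_eq_right (notch_le x)]
  congr 1
  rw [hf, indicator]
  rcases lt_or_gt_of_ne hxne with hlt | hlt
  · rw [notch_of_lt hxδ hmem hlt hx₀.2, if_neg fun hh => (hlt.trans hh.1).false]; ring
  · rw [notch_of_mem hx₀.1 hmem hlt.le]
    split_ifs with hx2
    · rw [min_eq_right (by linarith [hx2.2])]; ring
    · rw [min_eq_left]
      · ring
      · by_contra! h3
        exact hx2 ⟨hlt, by linarith⟩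

/-! ### Lengths of the graph and of the cuts. -/

theorem isometry_horizontal (a : ℝ) : Isometry fun x : ℝ => (!₂[x, a] : Plane) :=
  Isometry.of_dist_eq fun x y => by
    simp [EuclideanSpace.dist_eq, Fin.sum_univ_two, Real.sqrt_sq_eq_abs, Real.dist_eq]

theorem isometry_vertical (a : ℝ) : Isometry fun y : ℝ => (!₂[a, y] : Plane) :=
  Isometry.of_dist_eq fun x y => by
    simp [EuclideanSpace.dist_eq, Fin.sum_univ_two, Real.sqrt_sq_eq_abs, Real.dist_eq]

theorem lipschitzWith_diagonal (a : ℝ) :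
    LipschitzWith (NNReal.sqrt 2) fun x : ℝ => (!₂[x, a + x] : Plane) :=
  LipschitzWith.of_dist_le_mul fun x y => by
    simp only [EuclideanSpace.dist_eq, Fin.sum_univ_two, Real.dist_eq]
    simp only [Fin.isValue, Matrix.cons_val_zero, Matrix.cons_val_one, add_sub_add_left_eq_sub,
      sq_abs, Real.coe_sqrt, NNReal.coe_ofNat]
    rw [← two_mul, Real.sqrt_mul (by norm_num), Real.sqrt_sq_eq_abs]

open scoped MeasureTheory

theorem hausdorffMeasure_horizontal (a : ℝ) (s : Set ℝ) :
    μH[1] ((fun x : ℝ => (!₂[x, a] : Plane)) '' s) = volume s := by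
  rw [(isometry_horizontal a).hausdorffMeasure_image (Or.inl zero_le_one), hausdorffMeasure_real]

theorem hausdorffMeasure_vertical (a : ℝ) (s : Set ℝ) :
    μH[1] ((fun y : ℝ => (!₂[a, y] : Plane)) '' s) = volume s := by
  rw [(isometry_vertical a).hausdorffMeasure_image (Or.inl zero_le_one), hausdorffMeasure_real]

theorem hausdorffMeasure_diagonal_le (a : ℝ) (s : Set ℝ) :
    μH[1] ((fun x : ℝ => (!₂[x, a + x] : Plane)) '' s) ≤ ENNReal.ofReal √2 * volume s := by
  have := (lipschitzWith_diagonal a).hausdorffMeasure_image_le zero_le_one s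
  rw [hausdorffMeasure_real, ENNReal.rpow_one] at this
  refine this.trans (le_of_eq ?_)
  congr 1
  rw [ENNReal.ofReal, ← Real.coe_toNNReal 2 zero_le_two, ← Real.coe_sqrt, Real.toNNReal_coe]
  simp

theorem rightLim_of_tendsto_punctured {h : ℝ → ℝ} {c x : ℝ} (hc : Tendsto h (𝓝[≠] x) (𝓝 c)) :
    Function.rightLim h x = c :=
  rightLim_eq_of_tendsto (hc.mono_left (nhdsGT_le_nhdsNE x))

theorem leftLim_of_tendsto_punctured {h : ℝ → ℝ} {c x : ℝ} (hc : Tendsto h (𝓝[≠] x) (𝓝 c)) :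
    Function.leftLim h x = c :=
  leftLim_eq_of_tendsto (hc.mono_left (nhdsLT_le_nhdsNE x))

theorem graphSet_of_tendsto_punctured (ℓ : ℝ) {h : ℝ → ℝ} {c : ℝ}
    (hc : ∀ x, Tendsto h (𝓝[≠] x) (𝓝 c)) :
    graphSet ℓ h = (fun x : ℝ => (!₂[x, c] : Plane)) '' Ico 0 ℓ := by
  ext z
  simp only [graphSet, lowerLim, upperLim, rightLim_of_tendsto_punctured (hc _),
    leftLim_of_tendsto_punctured (hc _), min_self, max_self, mem_ofPred_eq, mem_image]
  constructor
  · rintro ⟨h1, h2, h3⟩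
    exact ⟨z 0, h1, by rw [le_antisymm h2 h3, eta_plane]⟩
  · rintro ⟨x, hx, rfl⟩
    simpa using hx

theorem hausdorffMeasure_graphSet {ℓ : ℝ} {h : ℝ → ℝ} {c : ℝ}
    (hc : ∀ x, Tendsto h (𝓝[≠] x) (𝓝 c)) : μH[1] (graphSet ℓ h) = ENNReal.ofReal ℓ := by
  rw [graphSet_of_tendsto_punctured ℓ hc, hausdorffMeasure_horizontal]
  simp

/-- Two horizontal pieces of total length `ℓ - δ`, a wall of length `δ` and a hypotenuse of length
`√2 * δ` cover the graph. The wall exactly replaces the missing horizontal piece. -/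
theorem hausdorffMeasure_graphSet_notchedProfile_le {ℓ c δ x₀ t : ℝ} {h : ℝ → ℝ} (hℓ : 0 < ℓ)
    (hδ : 0 ≤ δ) (hx₀ : x₀ ∈ Ico 0 ℓ) (hxδ : x₀ + δ < ℓ)
    (hc : ∀ x, Tendsto h (𝓝[≠] x) (𝓝 c)) :
    μH[1] (graphSet ℓ (notchedProfile ℓ c δ x₀ t h)) ≤ ENNReal.ofReal (ℓ + √2 * δ) := by
  have hδℓ : δ < ℓ := by linarith [hx₀.1]
  have hsub : graphSet ℓ (notchedProfile ℓ c δ x₀ t h) ⊆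
      (((fun x : ℝ => (!₂[x, t + c] : Plane)) '' Ico 0 x₀ ∪
        (fun x : ℝ => (!₂[x, t + c] : Plane)) '' Ico (x₀ + δ) ℓ) ∪
      (fun y : ℝ => (!₂[x₀, y] : Plane)) '' Icc (t + c - δ) (t + c)) ∪
      (fun x : ℝ => (!₂[x, (t + c - δ - x₀) + x] : Plane)) '' Icc x₀ (x₀ + δ) := by
    rintro z ⟨hz0, hz1, hz2⟩
    rw [lowerLim_notchedProfile hℓ hδℓ hc] at hz1
    by_cases hne : z 0 = x₀
    · left; right
      rw [hne, notch_self hδ] at hz1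
      rw [hne, upperLim_notchedProfile_self hℓ hδℓ hc] at hz2
      exact ⟨z 1, ⟨by linarith, hz2⟩, by rw [← hne]; exact eta_plane z⟩
    · rw [upperLim_notchedProfile hℓ hc hz0 hx₀ hne] at hz2
      have hz := le_antisymm hz2 hz1
      rcases lt_or_gt_of_ne hne with hlt | hlt
      · rw [notch_of_lt hxδ hz0 hlt hx₀.2] at hz
        left; left; left
        exact ⟨z 0, ⟨hz0.1, hlt⟩, by rw [← hz]; exact eta_plane z⟩
      · rw [notch_of_mem hx₀.1 hz0 hlt.le] at hz
        by_cases hle : x₀ + δ ≤ z 0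
        · rw [min_eq_left (by linarith)] at hz
          left; left; right
          refine ⟨z 0, ⟨hle, hz0.2⟩, ?_⟩
          dsimp only
          rw [show t + c = z 1 by rw [hz]; ring, eta_plane]
        · rw [min_eq_right (by linarith)] at hz
          right
          refine ⟨z 0, ⟨hlt.le, by linarith⟩, ?_⟩
          dsimp only
          rw [show t + c - δ - x₀ + z 0 = z 1 by rw [hz]; ring, eta_plane]
  refine (measure_mono hsub).trans ?_
  refine (measure_union_le _ _).trans ?_
  refine (add_le_add ((measure_union_le _ _).trans
    (add_le_add (measure_union_le _ _) le_rfl)) (hausdorffMeasure_diagonal_le _ _)).trans ?_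
  simp only [hausdorffMeasure_horizontal, hausdorffMeasure_vertical, Real.volume_Ico,
    Real.volume_Icc]
  have hs : 0 ≤ √2 := Real.sqrt_nonneg 2
  rw [← ENNReal.ofReal_mul hs, ← ENNReal.ofReal_add (by linarith [hx₀.1]) (by linarith),
    ← ENNReal.ofReal_add (by linarith [hx₀.1]) (by linarith),
    ← ENNReal.ofReal_add (by linarith [hx₀.1]) (mul_nonneg hs (by linarith))]
  apply ENNReal.ofReal_le_ofReal
  ring_nf
  exact le_rfl

/-- The new cuts, lowered by `t`, lie inside the old ones and miss the top segment of length `δ` at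
`x₀`, which the notch has opened. -/
theorem hausdorffMeasure_verticalCracks_notchedProfile_add_le {ℓ c δ x₀ t : ℝ} {h : ℝ → ℝ}
    (hℓ : 0 < ℓ) (hδ : 0 < δ) (hx₀ : x₀ ∈ Ico 0 ℓ) (hxδ : x₀ + δ < ℓ)
    (hc : ∀ x, Tendsto h (𝓝[≠] x) (𝓝 c)) (hcut : h x₀ ≤ c - δ) :
    μH[1] (verticalCracks ℓ (notchedProfile ℓ c δ x₀ t h)) + ENNReal.ofReal δ ≤
      μH[1] (verticalCracks ℓ h) := by
  have hδℓ : δ < ℓ := by linarith [hx₀.1]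
  have hlow : ∀ x, lowerLim h x = c := fun x => by
    rw [lowerLim, rightLim_of_tendsto_punctured (hc x), leftLim_of_tendsto_punctured (hc x),
      min_self]
  -- Open at the bottom, since `c - δ` may still be the top of the remaining cut. Additivity needs
  -- only `S` to be measurable.
  set S : Set Plane := (fun y : ℝ => (!₂[x₀, y] : Plane)) '' Ioc (c - δ) c with hS
  set A := verticalCracks ℓ (notchedProfile ℓ c δ x₀ t h) with hA
  have hSmeas : MeasurableSet S := by
    have : S = planeEquiv ⁻¹' ({x₀} ×ˢ Ioc (c - δ) c) := by
      ext z
      simp only [hS, mem_image, mem_preimage, planeEquiv_apply, mem_prod, mem_singleton_iff]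
      constructor
      · rintro ⟨y, hy, rfl⟩; exact ⟨rfl, hy⟩
      · rintro ⟨h1, h2⟩; exact ⟨z 1, h2, by rw [← h1, eta_plane]⟩
    rw [this]
    exact planeEquiv.measurable ((measurableSet_singleton _).prod measurableSet_Ioc)
  have hSμ : μH[1] S = ENNReal.ofReal δ := by
    rw [hS, hausdorffMeasure_vertical, Real.volume_Ioc]; congr 1; ring
  have hshift : μH[1] A = μH[1] ((IsometryEquiv.addRight (t • e₂)) ⁻¹' A) :=
    ((IsometryEquiv.addRight (t • e₂)).hausdorffMeasure_preimage 1 A).symm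
  have hmem : ∀ z, z ∈ (IsometryEquiv.addRight (t • e₂)) ⁻¹' A →
      z ∈ verticalCracks ℓ h ∧ z ∉ S := by
    rintro z ⟨h1, h2, h3, h4⟩
    simp only [IsometryEquiv.addRight_apply, add_smul_e₂_zero, add_smul_e₂_one] at h1 h2 h3 h4
    rw [lowerLim_notchedProfile hℓ hδℓ hc] at h2 h4
    unfold notchedProfile at h2 h3
    have h5 : h (z 0) < notch ℓ c δ x₀ (z 0) := by
      have : min (h (z 0)) (notch ℓ c δ x₀ (z 0)) < notch ℓ c δ x₀ (z 0) := by linarith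
      exact (min_lt_iff.1 this).resolve_right (lt_irrefl _)
    rw [min_eq_left h5.le] at h3
    have h6 := notch_le (ℓ := ℓ) (c := c) (δ := δ) (x₀ := x₀) (z 0)
    refine ⟨⟨h1, ?_, ?_, ?_⟩, ?_⟩
    · rw [hlow]; linarith
    · linarith
    · rw [hlow]; linarith
    · rintro ⟨y, hy, rfl⟩
      simp only [Matrix.cons_val_zero, Matrix.cons_val_one] at h4
      rw [notch_self hδ.le] at h4
      linarith [hy.1]
  rw [hshift, ← hSμ, ← measure_union _ hSmeas]
  · refine measure_mono (union_subset (fun z hz => (hmem z hz).1) ?_)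
    rintro _ ⟨y, hy, rfl⟩
    refine ⟨hx₀, ?_, ?_, ?_⟩
    · rw [hlow]; simp only [Matrix.cons_val_zero]; linarith
    · simp only [Matrix.cons_val_zero, Matrix.cons_val_one]; linarith [hy.1]
    · rw [hlow]; exact hy.2
  · exact disjoint_left.2 fun z hz => (hmem z hz).2

/-! ### Regularized dislocation measures -/

theorem Mollifier.scaled_eq_zero (ϱ : Mollifier) {r₀ : ℝ} (hr₀ : 0 < r₀) {z : Plane}
    (hz : r₀ ≤ ‖z‖) : ϱ.scaled r₀ z = 0 := by
  have : r₀⁻¹ • z ∉ tsupport ϱ.toFun := fun hmem => by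
    have h2 := ϱ.tsupport_subset hmem
    rw [mem_ball_zero_iff, norm_smul, norm_inv, Real.norm_eq_abs, abs_of_pos hr₀,
      inv_mul_lt_iff₀ hr₀, mul_one] at h2
    exact h2.not_ge hz
  simp [Mollifier.scaled, image_eq_zero_of_notMem_tsupport this]

theorem periodicDirac_add (ℓ : ℝ) (z v : Plane) :
    periodicDirac ℓ (z + v) = (periodicDirac ℓ z).map (· + v) := by
  rw [periodicDirac, periodicDirac, Measure.map_sum (measurable_add_const v).aemeasurable]
  congr 1
  funext m
  refine Eq.trans ?_ (Measure.map_dirac' (measurable_add_const v) _).symm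
  congr 1
  abel

theorem periodicDirac_add_period (ℓ : ℝ) (z : Plane) :
    periodicDirac ℓ (z + ℓ • e₁) = periodicDirac ℓ z := by
  ext s hs
  rw [periodicDirac, periodicDirac, Measure.sum_apply _ hs, Measure.sum_apply _ hs,
    ← (Equiv.addRight (1 : ℤ)).tsum_eq
      (fun m : ℤ => Measure.dirac (z + ((m : ℝ) * ℓ) • e₁) s)]
  refine tsum_congr fun m => ?_
  congr 2
  simp only [Equiv.coe_addRight, Int.cast_add, Int.cast_one, add_mul, one_mul, add_smul]
  abel

theorem isLocallyFiniteMeasure_periodicDirac {ℓ : ℝ} (hℓ : 0 < ℓ) (z : Plane) :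
    IsLocallyFiniteMeasure (periodicDirac ℓ z) := by
  refine ⟨fun w => ⟨Metric.ball w 1, Metric.ball_mem_nhds w one_pos, ?_⟩⟩
  have hfin : {m : ℤ | z + ((m : ℝ) * ℓ) • e₁ ∈ Metric.ball w 1}.Finite := by
    refine (finite_Icc ⌊(w 0 - z 0 - 1) / ℓ⌋ ⌈(w 0 - z 0 + 1) / ℓ⌉).subset fun m hm => ?_
    have h1 : ‖(z + ((m : ℝ) * ℓ) • e₁ - w) 0‖ < 1 :=
      (PiLp.norm_apply_le _ 0).trans_lt (by simpa [dist_eq_norm] using hm)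
    rw [PiLp.sub_apply, add_smul_e₁_zero, Real.norm_eq_abs, abs_lt] at h1
    constructor
    · have h2 : (w 0 - z 0 - 1) / ℓ ≤ m := by rw [div_le_iff₀ hℓ]; linarith
      exact Int.cast_le.1 ((Int.floor_le _).trans h2)
    · have h2 : (m : ℝ) ≤ (w 0 - z 0 + 1) / ℓ := by rw [le_div_iff₀ hℓ]; linarith
      exact Int.cast_le.1 (h2.trans (Int.le_ceil _))
  rw [periodicDirac, Measure.sum_apply _ measurableSet_ball,
    tsum_eq_sum (s := hfin.toFinset) fun m hm => ?_]
  · exact ENNReal.sum_lt_top.2 fun m _ => measure_lt_top _ _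
  · rw [Measure.dirac_apply' _ measurableSet_ball, indicator_of_notMem]
    simpa using hm

section Regularized

variable {k : ℕ} {ℓ r₀ : ℝ} (ϱ : Mollifier) (b z : Fin k → Plane)

theorem regularized_dislocationMeasure (w : Plane) :
    regularized ϱ r₀ (dislocationMeasure ℓ b z) w =
      ∑ i, (∫ u, ϱ.scaled r₀ (w - u) ∂(periodicDirac ℓ (z i))) • b i := rfl

/-- Used for the vertical lift and, with `v = ℓ • e₁`, for the periodicity of the density. -/
theorem regularized_shift (v w : Plane) :
    regularized ϱ r₀ (dislocationMeasure ℓ b fun i => z i + v) w =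
      regularized ϱ r₀ (dislocationMeasure ℓ b z) (w - v) := by
  simp only [regularized_dislocationMeasure]
  refine Finset.sum_congr rfl fun i _ => ?_
  have := (MeasurableEquiv.addRight v).measurableEmbedding.integral_map
    (μ := periodicDirac ℓ (z i)) (fun u => ϱ.scaled r₀ (w - u))
  rw [MeasurableEquiv.coe_addRight] at this
  rw [periodicDirac_add, this]
  congr 2
  funext u
  congr 1
  change w - (u + v) = w - v - u
  abel

theorem regularized_sub_period (w : Plane) :
    regularized ϱ r₀ (dislocationMeasure ℓ b z) (w - ℓ • e₁) =
      regularized ϱ r₀ (dislocationMeasure ℓ b z) w := by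
  rw [← regularized_shift]
  simp only [regularized_dislocationMeasure, periodicDirac_add_period]

theorem continuous_regularized (hℓ : 0 < ℓ) :
    Continuous (regularized ϱ r₀ (dislocationMeasure ℓ b z)) := by
  have : regularized ϱ r₀ (dislocationMeasure ℓ b z) = fun w =>
      ∑ i, (∫ u, ϱ.scaled r₀ (w - u) ∂(periodicDirac ℓ (z i))) • b i := rfl
  rw [this]
  refine continuous_finsetSum _ fun i _ => Continuous.fun_smul ?_ continuous_const
  have hlf := isLocallyFiniteMeasure_periodicDirac hℓ (z i)
  have hsupp : HasCompactSupport (ϱ.scaled r₀) := by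
    have := (ϱ.hasCompactSupport_kernel r₀ 0).comp_homeomorph (Homeomorph.neg Plane)
    convert! this using 1
    funext u
    simp
  have hcont : Continuous (ϱ.scaled r₀) := by
    have := (ϱ.continuous_kernel r₀ 0).comp (continuous_neg (G := Plane))
    simpa [Function.comp_def] using this
  -- Each summand is the convolution of the constant `1` with the kernel, relative to the locally
  -- finite measure `periodicDirac ℓ (z i)`.
  have := hsupp.continuous_convolution_right (ContinuousLinearMap.mul ℝ ℝ)
    (locallyIntegrable_const (1 : ℝ) (μ := periodicDirac ℓ (z i))) hcont
  refine this.congr fun w => ?_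
  simp [convolution_def]

/-- Nothing is spread below the cores. As cores in the film have height at least `r₀`, the layer
inserted under it is curl free. -/
theorem regularized_eq_zero (hr₀ : 0 < r₀) {w : Plane}
    (hw : ∀ i, w 1 ≤ z i 1 - r₀) :
    regularized ϱ r₀ (dislocationMeasure ℓ b z) w = 0 := by
  rw [regularized_dislocationMeasure]
  refine Finset.sum_eq_zero fun i _ => ?_
  rw [integral_eq_zero_of_ae, zero_smul]
  refine Measure.ae_sum_iff.2 fun m => ?_
  rw [ae_dirac_eq, eventually_pure]
  refine ϱ.scaled_eq_zero hr₀ ?_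
  have h1 := PiLp.norm_apply_le (w - (z i + ((m : ℝ) * ℓ) • e₁)) 1
  rw [PiLp.sub_apply, add_smul_e₁_one, Real.norm_eq_abs] at h1
  have h2 := neg_le_abs (w 1 - z i 1)
  have := hw i
  linarith

end Regularized

/-- A ball contained in the half plane `y > 0` has its centre at height at least its radius. -/
theorem le_height_of_ball_subset {h : ℝ → ℝ} {q : Plane} {r : ℝ} (hq0 : 0 ≤ q 1)
    (hq : Metric.ball q r ⊆ filmSharp h) : r ≤ q 1 := by
  by_contra! hlt
  have h1 : q - q 1 • e₂ ∈ Metric.ball q r := by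
    rw [Metric.mem_ball, dist_eq_norm, sub_sub_cancel_left, norm_neg, norm_smul]
    simpa [e₂, abs_of_nonneg hq0] using hlt
  have h2 := (hq h1).1
  rw [sub_smul_e₂_one] at h2
  linarith

/-- A ball contained in the film of height at most `c` has its centre at depth at least its
radius. -/
theorem height_add_le_of_ball_subset {h : ℝ → ℝ} {c : ℝ} (hc : ∀ x, h x ≤ c) {q : Plane} {r : ℝ}
    (hqc : q 1 ≤ c) (hq : Metric.ball q r ⊆ filmSharp h) : q 1 + r ≤ c := by
  by_contra! hlt
  have h1 : q + (c - q 1) • e₂ ∈ Metric.ball q r := by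
    rw [Metric.mem_ball, dist_eq_norm, add_sub_cancel_left, norm_smul]
    have : |c - q 1| < r := by rw [abs_of_nonneg (by linarith)]; linarith
    simpa [e₂] using this
  have h2 := (hq h1).2
  rw [add_smul_e₂_one, add_smul_e₂_zero] at h2
  linarith [hc (q 0)]

theorem mem_ball_plane {p q : Plane} {r : ℝ} (hr : 0 < r) :
    p ∈ Metric.ball q r ↔ (p 0 - q 0) ^ 2 + (p 1 - q 1) ^ 2 < r ^ 2 := by
  rw [Metric.mem_ball, EuclideanSpace.dist_eq, Fin.sum_univ_two, Real.sqrt_lt' hr, Real.dist_eq,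
    Real.dist_eq, sq_abs, sq_abs]

/-- A ball in the film which avoids a vertical cut of depth at least `D` stays below a notch that
is small with respect to `D`. -/
theorem lt_notch_of_mem_ball {ℓ c δ x₀ r D : ℝ} {h : ℝ → ℝ} (hℓ : 0 < ℓ) (hr : 0 < r)
    (hh : AdmissibleProfile ℓ h) (hc : ∀ x, h x ≤ c) (hD : 0 < D) (hDr : D ≤ r)
    (hcut : h x₀ ≤ c - D) (hδD : δ ≤ D / 8) {q p : Plane} (hqc : q 1 ≤ c)
    (hq : Metric.ball q r ⊆ filmSharp h) (hp : p ∈ Metric.ball q r) (hδ : 0 ≤ δ) :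
    p 1 < notch ℓ c δ x₀ (p 0) := by
  by_contra! hlt
  have hpc : p 1 < c := (hq hp).2.trans_le (hc _)
  have hlow := (le_notch (c := c) (x₀ := x₀) hℓ hδ (p 0)).trans hlt
  obtain ⟨m, hm1, hm2⟩ := exists_int_of_notch_lt hℓ (hlt.trans_lt hpc)
  have hX : h (x₀ + m * ℓ) ≤ c - D := by
    rw [show h (x₀ + m * ℓ) = h x₀ from hh.periodic.int_mul m x₀]; exact hcut
  set X := x₀ + m * ℓ
  have hout : (!₂[X, c - D] : Plane) ∉ Metric.ball q r := fun hmem => by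
    have := (hq hmem).2
    simp only [Matrix.cons_val_zero, Matrix.cons_val_one] at this
    linarith
  rw [mem_ball_plane hr] at hout hp
  simp only [Matrix.cons_val_zero, Matrix.cons_val_one, not_lt] at hout
  -- The centre lies at depth `c - q 1 ≥ r`. Hence moving down from `(X, c)` by `D ≤ r` lowers the
  -- squared distance to `q` by at least `D * r`.
  have hqr := height_add_le_of_ball_subset hc hqc hq
  have hx : |p 0 - q 0| < r := abs_lt_of_sq_lt_sq (by nlinarith [sq_nonneg (p 1 - q 1)]) hr.le
  have hy : |p 1 - q 1| < r := abs_lt_of_sq_lt_sq (by nlinarith [sq_nonneg (p 0 - q 0)]) hr.le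
  rw [abs_lt] at hx hy
  have h1 : (X - q 0) ^ 2 ≤ (p 0 - q 0) ^ 2 + 2 * δ * r + δ ^ 2 := by
    nlinarith [mul_nonneg (sub_nonneg.2 hm1) hδ, mul_nonneg (sub_nonneg.2 hm1) hr.le]
  have h2 : (c - q 1) ^ 2 ≤ (p 1 - q 1) ^ 2 + 2 * δ * r + δ ^ 2 := by
    nlinarith
  -- By `h1` and `h2` the squared distance from `(X, c)` to `q` is below `r ^ 2 + 4 * δ * r + 2 * δ
  -- ^ 2`. With `δ ≤ D / 8` the excess is less than `D * r`, so `(X, c - D)` would be in the ball.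
  nlinarith

/-! ### Green's formula in a strip -/

section Test

variable {U : Set Plane} {φ : Plane → ℝ}

theorem IsTest.continuous_fderiv_apply (hφ : IsTest U φ) (v : Plane) :
    Continuous fun z => fderiv ℝ φ z v :=
  (hφ.smooth.continuous_fderiv (by simp)).clm_apply continuous_const

theorem IsTest.fderiv_eq_zero (hφ : IsTest U φ) {z : Plane} (hz : z ∉ U) : fderiv ℝ φ z = 0 := by
  by_contra hne
  exact hz (hφ.tsupport_subset (support_fderiv_subset ℝ hne))

theorem IsTest.eq_zero (hφ : IsTest U φ) {z : Plane} (hz : z ∉ U) : φ z = 0 :=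
  image_eq_zero_of_notMem_tsupport fun h => hz (hφ.tsupport_subset h)

theorem IsTest.hasCompactSupport_fderiv_apply (hφ : IsTest U φ) (v : Plane) :
    HasCompactSupport fun z => fderiv ℝ φ z v :=
  hφ.hasCompactSupport.fderiv_apply (𝕜 := ℝ) v

theorem IsTest.mono (hφ : IsTest U φ) {V : Set Plane} (hUV : U ⊆ V) : IsTest V φ :=
  ⟨hφ.smooth, hφ.hasCompactSupport, hφ.tsupport_subset.trans hUV⟩

theorem IsTest.integrable_horizontal (hφ : IsTest U φ) (a : ℝ) :
    Integrable fun x : ℝ => φ !₂[x, a] :=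
  (hφ.smooth.continuous.comp (isometry_horizontal a).continuous).integrable_of_hasCompactSupport
    (hφ.hasCompactSupport.comp_isClosedEmbedding (isometry_horizontal a).isClosedEmbedding)

theorem IsTest.hasDerivAt_vertical (hφ : IsTest U φ) (x y : ℝ) :
    HasDerivAt (fun s : ℝ => φ !₂[x, s]) (fderiv ℝ φ !₂[x, y] e₂) y := by
  have h1 : HasDerivAt (fun s : ℝ => (!₂[x, s] : Plane)) e₂ y := by
    have h2 := ((hasDerivAt_id y).smul_const e₂).const_add (!₂[x, 0] : Plane)
    rw [one_smul] at h2
    convert! h2 using 1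
    funext s
    ext i
    fin_cases i <;> simp [e₂]
  have h3 := (hφ.smooth.differentiable (by simp) (!₂[x, y] : Plane)).hasFDerivAt
  exact h3.comp_hasDerivAt y h1

theorem measurableSet_strip (a b : ℝ) : MeasurableSet {z : Plane | a < z 1 ∧ z 1 ≤ b} := by
  have h1 : Measurable fun z : Plane => z 1 := Continuous.measurable (by fun_prop)
  exact h1 measurableSet_Ioc

/-- Since `∂ᵧ A = -G`, the integrand is `∂ᵧ (A φ)`: Fubini and the fundamental theorem of calculus
on vertical lines. -/
theorem strip_green (hφ : IsTest U φ) {A G : Plane → ℝ} (hA : Continuous A) (hG : Continuous G)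
    (hAG : ∀ x y, HasDerivAt (fun s : ℝ => A !₂[x, s]) (-G !₂[x, y]) y) {a b : ℝ} (hab : a ≤ b) :
    ∫ z in {z : Plane | a < z 1 ∧ z 1 ≤ b}, (A z * fderiv ℝ φ z e₂ - G z * φ z) =
      ∫ x : ℝ, (A !₂[x, b] * φ !₂[x, b] - A !₂[x, a] * φ !₂[x, a]) := by
  set F : Plane → ℝ := fun z => A z * fderiv ℝ φ z e₂ - G z * φ z with hF
  have hFc : Continuous F :=
    (hA.mul (hφ.continuous_fderiv_apply e₂)).sub (hG.mul hφ.smooth.continuous)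
  have hFs : HasCompactSupport F :=
    ((hφ.hasCompactSupport_fderiv_apply e₂).mul_left (f := A)).sub
      (hφ.hasCompactSupport.mul_left (f := G))
  have hFint : Integrable F := hFc.integrable_of_hasCompactSupport hFs
  have hpre : {z : Plane | a < z 1 ∧ z 1 ≤ b} =
      planeEquiv ⁻¹' ((univ : Set ℝ) ×ˢ Ioc a b) := by
    ext z; simp [planeEquiv_apply]
  have h1 : ∫ z in {z : Plane | a < z 1 ∧ z 1 ≤ b}, F z =
      ∫ p in (univ : Set ℝ) ×ˢ Ioc a b, F !₂[p.1, p.2] := by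
    rw [hpre, ← measurePreserving_planeEquiv.setIntegral_preimage_emb
      planeEquiv.measurableEmbedding]
    simp only [planeEquiv_apply, eta_plane]
  have hint : Integrable (fun p : ℝ × ℝ => F !₂[p.1, p.2]) := by
    rw [← measurePreserving_planeEquiv.integrable_comp_emb planeEquiv.measurableEmbedding]
    simpa [Function.comp_def, planeEquiv_apply, eta_plane] using hFint
  rw [h1, Measure.volume_eq_prod, setIntegral_prod _ hint.integrableOn, setIntegral_univ]
  refine integral_congr_ae (Eventually.of_forall fun x => ?_)
  dsimp only
  rw [← intervalIntegral.integral_of_le hab,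
    intervalIntegral.integral_eq_sub_of_hasDerivAt (f := fun y => A !₂[x, y] * φ !₂[x, y])]
  · intro y _
    have := (hAG x y).mul (hφ.hasDerivAt_vertical x y)
    convert! this using 1
    simp only [hF]; ring
  · exact (hFc.comp (isometry_vertical x).continuous).intervalIntegrable _ _

end Test

/-- Test functions supported in the film vanish on `{y = 0}`, so the boundary term drops out. For
competitors only the trace identity has to be proved. -/
theorem HasTangentialTrace.isWeakCurl {h : ℝ → ℝ} {H : Plane → Mat} {g : Plane → Plane}
    {τ : Plane} (hH : HasTangentialTrace h H g τ) : IsWeakCurl (filmSharp h) H g := by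
  intro φ hφ i
  rw [hH φ (hφ.mono (filmSharp_subset_subgraph h)) i]
  have : ∀ x : ℝ, φ !₂[x, 0] = 0 := fun x => hφ.eq_zero fun hx => by
    simpa using hx.1
  simp [this]

theorem memLp_of_continuous_of_isCompact {E : Type*} [NormedAddCommGroup E] {f : Plane → E}
    [SecondCountableTopologyEither Plane E] (hf : Continuous f) {K S : Set Plane} (hK : IsCompact K)
    (hS : S ⊆ K) (p : ENNReal) : MemLp f p (volume.restrict S) := by
  have : IsFiniteMeasure (volume.restrict K) := ⟨by simpa using hK.measure_lt_top⟩
  obtain ⟨C, hC⟩ := hK.exists_bound_of_continuousOn hf.continuousOn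
  have h1 : MemLp f p (volume.restrict K) :=
    MemLp.of_bound hf.aestronglyMeasurable C
      ((ae_restrict_iff' hK.measurableSet).2 (Eventually.of_forall hC))
  exact h1.mono_measure (Measure.restrict_mono hS le_rfl)

/-- The film lies in a compact rectangle. -/
theorem film_subset_isCompact (ℓ : ℝ) {h : ℝ → ℝ} {C : ℝ} (hC : ∀ x, h x ≤ C) :
    ∃ K : Set Plane, IsCompact K ∧ film ℓ h ⊆ K := by
  refine ⟨(fun p : ℝ × ℝ => (!₂[p.1, p.2] : Plane)) '' (Icc 0 ℓ ×ˢ Icc 0 C),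
    (isCompact_Icc.prod isCompact_Icc).image (continuous_mkPlane continuous_fst continuous_snd), ?_⟩
  rintro z ⟨h1, h2, h3⟩
  exact ⟨(z 0, z 1), ⟨⟨h1.1, h1.2.le⟩, h2.le, h3.le.trans (hC _)⟩, eta_plane z⟩

theorem exists_curl_of_continuous {ℓ : ℝ} {h : ℝ → ℝ} {H : Plane → Mat} {g : Plane → Plane} {C : ℝ}
    (hg : Continuous g) (hC : ∀ x, h x ≤ C)
    (hcurl : IsWeakCurl (filmSharp h) (periodicExt ℓ H) g) :
    ∃ g : Plane → Plane, IsWeakCurl (filmSharp h) (periodicExt ℓ H) g ∧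
      MemLp g 2 (volume.restrict (film ℓ h)) ∧
      ∀ K : Set Plane, IsCompact K → K ⊆ filmSharp h → MemLp g 2 (volume.restrict K) := by
  obtain ⟨K, hK, hsub⟩ := film_subset_isCompact ℓ hC
  exact ⟨g, hcurl, memLp_of_continuous_of_isCompact hg hK hsub 2,
    fun K hK _ => memLp_of_continuous_of_isCompact hg hK Subset.rfl 2⟩

/-! ### The flat film -/

/-- The field with tangential part `τ - ∫₀^y g` and no normal part, whose curl is `g`. -/
def primitiveField (τ : Plane) (g : Plane → Plane) (z : Plane) : Mat :=
  Matrix.of fun i j => if j = 0 then τ i - ∫ s in (0 : ℝ)..z 1, g !₂[z 0, s] i else 0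

section PrimitiveField

variable {τ : Plane} {g : Plane → Plane}

theorem continuous_primitiveField (hg : Continuous g) (i j : Fin 2) :
    Continuous fun z => primitiveField τ g z i j := by
  by_cases hj : j = 0
  · simp only [primitiveField, Matrix.of_apply, if_pos hj]
    refine continuous_const.sub
      (intervalIntegral.continuous_parametric_intervalIntegral_of_continuous
        (f := fun (z : Plane) s => g !₂[z 0, s] i) ?_ (by fun_prop))
    have h1 : Continuous fun p : Plane × ℝ => (!₂[p.1 0, p.2] : Plane) :=
      continuous_mkPlane (by fun_prop) continuous_snd
    have h2 := hg.comp h1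
    change Continuous fun p : Plane × ℝ => g !₂[p.1 0, p.2] i
    exact (PiLp.continuous_apply 2 _ i).comp h2
  · simp only [primitiveField, Matrix.of_apply, if_neg hj]
    exact continuous_const

theorem hasTangentialTrace_primitiveField (hg : Continuous g) {c : ℝ} (hc : 0 ≤ c) :
    HasTangentialTrace (fun _ => c) (primitiveField τ g) g τ := by
  intro φ hφ i
  have hgi : Continuous fun z => g z i := (PiLp.continuous_apply 2 _ i).comp hg
  have hA := continuous_primitiveField (τ := τ) hg i 0
  have hder : ∀ x y : ℝ, HasDerivAt (fun s : ℝ => primitiveField τ g !₂[x, s] i 0)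
      (-(g !₂[x, y] i)) y := by
    intro x y
    have hcont : Continuous fun s : ℝ => g !₂[x, s] i := hgi.comp (isometry_vertical x).continuous
    have := (intervalIntegral.integral_hasDerivAt_right (hcont.intervalIntegrable 0 y)
      (hcont.stronglyMeasurableAtFilter _ _) hcont.continuousAt).const_sub (τ i)
    simpa [primitiveField] using this
  have hgreen := strip_green hφ hA hgi hder hc
  set S : Set Plane := {z : Plane | 0 < z 1 ∧ z 1 ≤ c}
  have hSmeas : MeasurableSet S := measurableSet_strip 0 c
  have hsub : filmSharp (fun _ => c) ⊆ S := fun z hz => ⟨hz.1, le_of_lt hz.2⟩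
  have hzero : ∀ z ∈ S \ filmSharp (fun _ => c), z ∉ subgraph (fun _ => c) :=
    fun z hz hz' => hz.2 ⟨hz.1.1, hz'⟩
  have i1 : Integrable fun z => primitiveField τ g z i 0 * fderiv ℝ φ z e₂ :=
    (hA.mul (hφ.continuous_fderiv_apply e₂)).integrable_of_hasCompactSupport
      ((hφ.hasCompactSupport_fderiv_apply e₂).mul_left)
  have i2 : Integrable fun z => g z i * φ z :=
    (hgi.mul hφ.smooth.continuous).integrable_of_hasCompactSupport hφ.hasCompactSupport.mul_left
  rw [← setIntegral_eq_of_subset_of_forall_sdiff_eq_zero hSmeas hsub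
      (fun z hz => by rw [hφ.eq_zero (hzero z hz), mul_zero]),
    ← setIntegral_eq_of_subset_of_forall_sdiff_eq_zero hSmeas hsub
      (fun z hz => by rw [hφ.fderiv_eq_zero (hzero z hz)]; simp)]
  rw [integral_sub i1.integrableOn i2.integrableOn] at hgreen
  have h1 : ∀ z, primitiveField τ g z i 1 = 0 := fun z => by simp [primitiveField]
  simp only [h1, zero_mul, sub_zero]
  have hright : ∫ x : ℝ, (primitiveField τ g !₂[x, c] i 0 * φ !₂[x, c] -
      primitiveField τ g !₂[x, 0] i 0 * φ !₂[x, 0]) = -∫ x : ℝ, τ i * φ !₂[x, 0] := by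
    rw [← integral_neg]
    refine integral_congr_ae (Eventually.of_forall fun x => ?_)
    have : φ !₂[x, c] = 0 := hφ.eq_zero fun hx => by simp [subgraph] at hx
    simp [this, primitiveField]
  linarith [hgreen.trans hright]

theorem periodicExt_primitiveField {ℓ : ℝ} (hg : ∀ z, g (z - ℓ • e₁) = g z) :
    periodicExt ℓ (primitiveField τ g) = primitiveField τ g := by
  have hz : ∀ (m : ℤ) (z : Plane), g (z - ((m : ℝ) * ℓ) • e₁) = g z := by
    have hper : Function.Periodic g (ℓ • e₁) := fun z => by
      rw [← hg (z + ℓ • e₁), add_sub_cancel_right]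
    intro m z
    rw [mul_smul]
    have := hper.sub_zsmul_eq m (x := z)
    rwa [← Int.cast_smul_eq_zsmul ℝ] at this
  funext z
  have key : ∀ s : ℝ, g !₂[z 0 - (⌊z 0 / ℓ⌋ : ℝ) * ℓ, s] = g !₂[z 0, s] := fun s => by
    rw [← hz ⌊z 0 / ℓ⌋ !₂[z 0, s]]
    congr 1
    ext i
    fin_cases i <;> simp [e₁]
  simp only [periodicExt, primitiveField, sub_smul_e₁_one, sub_smul_e₁_zero, key]

end PrimitiveField

theorem admissibleProfile_const {ℓ c : ℝ} (hc : 0 ≤ c) : AdmissibleProfile ℓ fun _ => c where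
  nonneg _ := hc
  lowerSemicontinuous := lowerSemicontinuous_const
  periodic _ := rfl
  boundedVariation := (MonotoneOn.boundedVariationOn (C := |c|)
    (fun _ _ _ _ _ => le_rfl) fun _ _ => le_rfl)

/-- This competitor only serves to show that the minimal energy is finite. -/
theorem admissible_primitiveField {k : ℕ} {ℓ r₀ e₀ c : ℝ} (hℓ : 0 < ℓ) (hc : 0 ≤ c)
    (ϱ : Mollifier) (b z : Fin k → Plane)
    (hz : ∀ i, z i ∈ film ℓ (fun _ => c) ∧ Metric.ball (z i) r₀ ⊆ filmSharp fun _ => c) :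
    Admissible ℓ r₀ e₀ ϱ b (fun _ => c) (dislocationMeasure ℓ b z)
      (primitiveField (e₀ • e₁) (regularized ϱ r₀ (dislocationMeasure ℓ b z))) := by
  have hg := continuous_regularized (r₀ := r₀) ϱ b z hℓ
  have hper := periodicExt_primitiveField (τ := e₀ • e₁)
    (regularized_sub_period (ℓ := ℓ) (r₀ := r₀) ϱ b z)
  have htr := hasTangentialTrace_primitiveField (τ := e₀ • e₁) hg hc
  have hcurl := htr.isWeakCurl
  rw [← hper] at htr hcurl
  refine ⟨admissibleProfile_const hc, ⟨z, hz, rfl⟩, ⟨fun K hK _ i j => ?_, ?_⟩, hcurl, htr⟩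
  · rw [hper]
    exact memLp_of_continuous_of_isCompact (continuous_primitiveField hg i j) hK inter_subset_left 2
  · exact exists_curl_of_continuous hg (fun _ => le_rfl) hcurl

open scoped MeasureTheory in
theorem totalEnergy_primitiveField_lt_top {ℓ lam mu γ c : ℝ} {τ : Plane} {g : Plane → Plane}
    (hg : Continuous g) :
    totalEnergy ℓ lam mu γ (fun _ => c) (primitiveField τ g) < ⊤ := by
  have htend : ∀ x : ℝ, Tendsto (fun _ : ℝ => c) (𝓝[≠] x) (𝓝 c) := fun _ => tendsto_const_nhds
  have hcracks : verticalCracks ℓ (fun _ : ℝ => c) = ∅ := by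
    ext z
    simp [verticalCracks, lowerLim, rightLim_of_tendsto_punctured (htend _),
      leftLim_of_tendsto_punctured (htend _)]
  rw [totalEnergy, hcracks, measure_empty, mul_zero, add_zero, hausdorffMeasure_graphSet htend]
  refine ENNReal.add_lt_top.2 ⟨?_, ENNReal.mul_lt_top ENNReal.ofReal_lt_top ENNReal.ofReal_lt_top⟩
  obtain ⟨K, hK, hsub⟩ := film_subset_isCompact ℓ (h := fun _ : ℝ => c) (fun _ => le_rfl)
  have hcont : Continuous fun z => elasticDensity lam mu (symPart (primitiveField τ g z)) := by
    have := fun i j => continuous_primitiveField (τ := τ) hg i j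
    have h0 := this 0 0
    have h1 := this 0 1
    have h2 := this 1 0
    have h3 := this 1 1
    simp only [elasticDensity, symPart, Matrix.trace, Fin.sum_univ_two, Matrix.diag_apply,
      Matrix.smul_apply, Matrix.add_apply, Matrix.transpose_apply, smul_eq_mul]
    fun_prop
  have h1 : IntegrableOn (fun z => elasticDensity lam mu (symPart (primitiveField τ g z)))
    (film ℓ fun _ => c) := memLp_one_iff_integrable.1
      (memLp_of_continuous_of_isCompact hcont hK hsub 1)
  refine lt_of_le_of_lt (lintegral_mono fun z => ?_) h1.2
  exact Real.ofReal_le_enorm _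

/-! ### Lifting a film onto a constant layer -/

/-- The constant field with tangential part `τ` and no normal part. -/
def layerMatrix (τ : Plane) : Mat := Matrix.of fun i j => if j = 0 then τ i else 0

/-- The field `H` lifted by `t`, over the constant field `layerMatrix τ` in `y ≤ t`. -/
def liftedField (t : ℝ) (τ : Plane) (H : Plane → Mat) (z : Plane) : Mat :=
  if t < z 1 then H (z - t • e₂) else layerMatrix τ

theorem periodicExt_liftedField (ℓ t : ℝ) (τ : Plane) (H : Plane → Mat) :
    periodicExt ℓ (liftedField t τ H) = liftedField t τ (periodicExt ℓ H) := by
  funext z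
  simp only [periodicExt, liftedField, sub_smul_e₁_one, sub_smul_e₂_zero]
  rw [sub_right_comm]

section Lift

variable {t : ℝ} {τ : Plane} {h g : ℝ → ℝ} {H : Plane → Mat} {G : Plane → Plane}

theorem measurePreserving_add_right_smul (v : Plane) :
    MeasurePreserving (MeasurableEquiv.addRight v) (volume : Measure Plane) volume :=
  measurePreserving_add_right volume v

/-- On the compact support of `φ`, square integrability gives integrability, and the derivative is
bounded. This permits the splitting of integrals in Green's formula. -/
theorem integrableOn_mul_test
    (hloc : ∀ K : Set Plane, IsCompact K → K ⊆ subgraph h → ∀ i j,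
      MemLp (fun z => H z i j) 2 (volume.restrict (K ∩ filmSharp h)))
    (hh : LowerSemicontinuous h) {φ : Plane → ℝ} (hφ : IsTest (subgraph h) φ) (i j : Fin 2)
    (v : Plane) : IntegrableOn (fun z => H z i j * fderiv ℝ φ z v) (filmSharp h) := by
  have hK : IsCompact (tsupport φ) := hφ.hasCompactSupport
  have hfin : IsFiniteMeasure (volume.restrict (tsupport φ ∩ filmSharp h)) :=
    ⟨by simpa using (measure_mono inter_subset_left).trans_lt hK.measure_lt_top⟩
  have h1 := (hloc _ hK hφ.tsupport_subset i j).integrable one_le_two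
  obtain ⟨C, hC⟩ := (hφ.continuous_fderiv_apply v).bounded_above_of_compact_support
    (hφ.hasCompactSupport_fderiv_apply v)
  have h2 := h1.mul_bdd (hφ.continuous_fderiv_apply v).aestronglyMeasurable
    (Eventually.of_forall hC)
  refine IntegrableOn.of_forall_sdiff_eq_zero (s := tsupport φ ∩ filmSharp h) h2
    (isOpen_filmSharp hh).measurableSet fun z hz => ?_
  have : z ∉ tsupport φ := fun hz' => hz.2 ⟨hz', hz.1⟩
  have h3 : fderiv ℝ φ z = 0 := by
    by_contra hne
    exact this (support_fderiv_subset ℝ hne)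
  rw [h3]; simp

theorem IsTest.comp_add_right {φ : Plane → ℝ} (hφ : IsTest (subgraph g) φ)
    (hgh : ∀ x, g x ≤ t + h x) : IsTest (subgraph h) fun z => φ (z + t • e₂) where
  smooth := hφ.smooth.comp (by fun_prop)
  hasCompactSupport := hφ.hasCompactSupport.comp_homeomorph (Homeomorph.addRight (t • e₂))
  tsupport_subset := by
    intro z hz
    have h1 : z + t • e₂ ∈ tsupport φ :=
      (tsupport_comp_subset_preimage φ (f := fun z => z + t • e₂) (by fun_prop)) hz
    have h2 : (z + t • e₂) 1 < g ((z + t • e₂) 0) := hφ.tsupport_subset h1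
    rw [add_smul_e₂_one, add_smul_e₂_zero] at h2
    change z 1 < h (z 0)
    linarith [hgh (z 0)]

/-- Lifting a film onto a constant layer with the same tangential trace preserves the curl and
the trace. -/
theorem hasTangentialTrace_liftedField (ht : 0 ≤ t) (hh : LowerSemicontinuous h)
    (hgh : ∀ x, g x ≤ t + h x)
    (hloc : ∀ K : Set Plane, IsCompact K → K ⊆ subgraph h → ∀ i j,
      MemLp (fun z => H z i j) 2 (volume.restrict (K ∩ filmSharp h)))
    (hG : ∀ z, z 1 ≤ 0 → G z = 0) (hH : HasTangentialTrace h H G τ) :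
    HasTangentialTrace g (liftedField t τ H) (fun z => G (z - t • e₂)) τ := by
  intro φ hφ i
  have hψ := hφ.comp_add_right hgh
  have hfd : ∀ z, fderiv ℝ (fun z => φ (z + t • e₂)) z = fderiv ℝ φ (z + t • e₂) := fun z =>
    fderiv_comp_add_right _
  have hmp := measurePreserving_add_right_smul (t • e₂)
  have hemb := (MeasurableEquiv.addRight (t • e₂ : Plane)).measurableEmbedding
  -- `U` is the lifted film, `S` the layer, and `T` the whole region below `t + h`. As `φ` vanishes
  -- above `g`, integrals over the film of `g` may be taken over `T`, so the notch plays no role.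
  set U : Set Plane := {z | t < z 1 ∧ z 1 < t + h (z 0)} with hU
  set T : Set Plane := filmSharp fun x => t + h x
  set S : Set Plane := {z : Plane | 0 < z 1 ∧ z 1 ≤ t}
  have hpre : filmSharp h = MeasurableEquiv.addRight (t • e₂ : Plane) ⁻¹' U := by
    ext z
    simp only [filmSharp, hU, mem_preimage, MeasurableEquiv.coe_addRight, mem_ofPred_eq,
      add_smul_e₂_zero, add_smul_e₂_one, add_comm t, add_lt_add_iff_right, lt_add_iff_pos_left]
  have hTmeas : MeasurableSet T := by
    refine (isOpen_filmSharp fun x y hy => ?_).measurableSet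
    filter_upwards [hh x (y - t) (by linarith)] with w hw
    linarith
  have hUT : U ⊆ T := fun z hz => ⟨ht.trans_lt hz.1, hz.2⟩
  have hgT : filmSharp g ⊆ T := fun z hz => ⟨hz.1, hz.2.trans_le (hgh _)⟩
  have hout : ∀ z ∈ T \ filmSharp g, z ∉ subgraph g := fun z hz hz' => hz.2 ⟨hz.1.1, hz'⟩
  have hTU : T ∩ {z | t < z 1} = U := by
    ext z
    exact ⟨fun hz => ⟨hz.2, hz.1.2⟩, fun hz => ⟨hUT hz, hz.1⟩⟩
  have hTS : T \ {z | t < z 1} ⊆ S := fun z hz => ⟨hz.1.1, not_lt.1 hz.2⟩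
  have hSout : ∀ z ∈ S \ (T \ {z | t < z 1}), z ∉ subgraph g := by
    intro z hz hz'
    refine hz.2 ⟨⟨hz.1.1, ?_⟩, not_lt.2 hz.1.2⟩
    exact (show z 1 < g (z 0) from hz').trans_le (hgh _)
  set k : Plane → ℝ := fun z =>
    liftedField t τ H z i 0 * fderiv ℝ φ z e₂ - liftedField t τ H z i 1 * fderiv ℝ φ z e₁ with hk
  -- the lifted field on the lifted film
  have hkU : ∀ z ∈ filmSharp h, k (z + t • e₂) =
      H z i 0 * fderiv ℝ (fun z => φ (z + t • e₂)) z e₂ -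
        H z i 1 * fderiv ℝ (fun z => φ (z + t • e₂)) z e₁ := by
    intro z hz
    have : t < (z + t • e₂) 1 := by rw [add_smul_e₂_one]; linarith [hz.1]
    simp only [hk, liftedField, if_pos this, add_sub_cancel_right, hfd]
  have hhmeas := (isOpen_filmSharp hh).measurableSet
  have hkUint : IntegrableOn k U := by
    rw [← hmp.integrableOn_comp_preimage hemb, ← hpre]
    refine IntegrableOn.congr_fun ((integrableOn_mul_test hloc hh hψ i 0 e₂).sub
      (integrableOn_mul_test hloc hh hψ i 1 e₁)) (fun z hz => ?_) hhmeas
    exact (hkU z hz).symm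
  have hUint : ∫ z in U, k z = ∫ z in filmSharp h,
      (H z i 0 * fderiv ℝ (fun z => φ (z + t • e₂)) z e₂ -
        H z i 1 * fderiv ℝ (fun z => φ (z + t • e₂)) z e₁) := by
    rw [← hmp.setIntegral_preimage_emb hemb k U, ← hpre]
    exact setIntegral_congr_fun hhmeas hkU
  have hGint : ∫ z in U, G (z - t • e₂) i * φ z =
      ∫ z in filmSharp h, G z i * φ (z + t • e₂) := by
    rw [← hmp.setIntegral_preimage_emb hemb _ U, ← hpre]
    simp [MeasurableEquiv.coe_addRight]
  -- the constant layer
  have hkS : ∀ z ∈ S, k z = τ i * fderiv ℝ φ z e₂ := by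
    intro z hz
    simp [hk, liftedField, layerMatrix, not_lt.2 hz.2]
  have hcint : Integrable fun z => τ i * fderiv ℝ φ z e₂ :=
    (continuous_const.mul (hφ.continuous_fderiv_apply e₂)).integrable_of_hasCompactSupport
      (hφ.hasCompactSupport_fderiv_apply e₂).mul_left
  have hSmeas : MeasurableSet S := measurableSet_strip 0 t
  have hupper : MeasurableSet {z : Plane | t < z 1} :=
    (isOpen_lt continuous_const (by fun_prop : Continuous fun w : Plane => w 1)).measurableSet
  have hkSint : IntegrableOn k S :=
    hcint.integrableOn.congr_fun (fun z hz => (hkS z hz).symm) hSmeas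
  have hkT : IntegrableOn k T := by
    refine (hkUint.union hkSint).mono_set fun z hz => ?_
    by_cases hz1 : t < z 1
    · exact Or.inl ⟨hz1, hz.2⟩
    · exact Or.inr ⟨hz.1, not_lt.1 hz1⟩
  have hkzero : ∀ z, z ∉ subgraph g → k z = 0 := fun z hz => by
    simp [hk, hφ.fderiv_eq_zero hz]
  -- The term at `y = t` is the trace term of the lifted film, and the one at `y = 0` cancels the
  -- trace term required of the new film.
  have hlayer : ∫ z in S, k z = (∫ x : ℝ, τ i * φ !₂[x, t]) - ∫ x : ℝ, τ i * φ !₂[x, 0] := by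
    rw [setIntegral_congr_fun hSmeas hkS, ← integral_sub
      ((hφ.integrable_horizontal t).const_mul _) ((hφ.integrable_horizontal 0).const_mul _)]
    have := strip_green hφ (A := fun _ => τ i) (G := fun _ => 0) continuous_const continuous_const
      (fun x y => by simpa using hasDerivAt_const y (τ i)) ht
    simpa using this
  have hkfilm : ∫ z in filmSharp g, k z = (∫ z in U, k z) + ∫ z in S, k z := by
    rw [← setIntegral_eq_of_subset_of_forall_sdiff_eq_zero hTmeas hgT
        (fun z hz => hkzero z (hout z hz)),
      ← integral_inter_add_sdiff hupper hkT, hTU,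
      setIntegral_eq_of_subset_of_forall_sdiff_eq_zero hSmeas hTS
        (fun z hz => hkzero z (hSout z hz))]
  have hGfilm : ∫ z in filmSharp g, G (z - t • e₂) i * φ z =
      ∫ z in U, G (z - t • e₂) i * φ z := by
    rw [← setIntegral_eq_of_subset_of_forall_sdiff_eq_zero hTmeas hgT
        (fun z hz => by rw [hφ.eq_zero (hout z hz), mul_zero]),
      ← setIntegral_eq_of_subset_of_forall_sdiff_eq_zero hTmeas hUT]
    intro z hz
    have hz1 : (z - t • e₂) 1 ≤ 0 := by
      rw [sub_smul_e₂_one]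
      by_contra! hlt
      exact hz.2 ⟨by linarith, hz.1.2⟩
    rw [hG _ hz1]; simp
  have hbot : ∀ x : ℝ, (!₂[x, 0] : Plane) + t • e₂ = !₂[x, t] := fun x => by
    ext i; fin_cases i <;> simp [e₂]
  have hmain := hH _ hψ i
  simp only [hbot] at hmain
  rw [hGfilm, hGint, hmain, hkfilm, hUint, hlayer]
  ring

/-- A compact set crossing `y = t` becomes, after lowering, one that crosses `y = 0`; here
integrability of `H` up to the interface is essential. -/
theorem memLp_loc_liftedField (hgmeas : LowerSemicontinuous g) (hgh : ∀ x, g x ≤ t + h x)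
    (hloc : ∀ K : Set Plane, IsCompact K → K ⊆ subgraph h → ∀ i j,
      MemLp (fun z => H z i j) 2 (volume.restrict (K ∩ filmSharp h)))
    {K : Set Plane} (hK : IsCompact K) (hKg : K ⊆ subgraph g) (i j : Fin 2) :
    MemLp (fun z => liftedField t τ H z i j) 2 (volume.restrict (K ∩ filmSharp g)) := by
  have hupper : MeasurableSet {z : Plane | t < z 1} :=
    (isOpen_lt continuous_const (by fun_prop : Continuous fun w : Plane => w 1)).measurableSet
  have hmp := measurePreserving_add_right_smul (t • e₂)
  have hemb := (MeasurableEquiv.addRight (t • e₂ : Plane)).measurableEmbedding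
  set S := K ∩ filmSharp g
  have hSmeas : MeasurableSet S := hK.measurableSet.inter (isOpen_filmSharp hgmeas).measurableSet
  have hfin : IsFiniteMeasure (volume.restrict S) :=
    ⟨by simpa using (measure_mono inter_subset_left).trans_lt hK.measure_lt_top⟩
  -- the lifted part
  have hK' : IsCompact ((Homeomorph.addRight (t • e₂ : Plane)) ⁻¹' K) :=
    (Homeomorph.isCompact_preimage _).2 hK
  have hsub : (Homeomorph.addRight (t • e₂ : Plane)) ⁻¹' K ⊆ subgraph h := by
    intro z hz
    have h2 : (z + t • e₂) 1 < g ((z + t • e₂) 0) := hKg hz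
    rw [add_smul_e₂_one, add_smul_e₂_zero] at h2
    change z 1 < h (z 0)
    linarith [hgh (z 0)]
  have h1 := hloc _ hK' hsub i j
  have h2 : MemLp (fun z => H (z - t • e₂) i j) 2 (volume.restrict (S ∩ {z | t < z 1})) := by
    have h3 := hmp.restrict_preimage_emb hemb (S ∩ {z | t < z 1})
    rw [← h3.map_eq, hemb.memLp_map_measure_iff]
    have h4 : (fun z => H (z - t • e₂) i j) ∘ (MeasurableEquiv.addRight (t • e₂ : Plane)) =
        fun z => H z i j := by
      funext z; simp
    rw [h4]
    refine h1.mono_measure (Measure.restrict_mono (fun z hz => ?_) le_rfl)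
    obtain ⟨⟨hzK, hzg⟩, hzt⟩ := hz
    refine ⟨hzK, ?_, hsub hzK⟩
    have : t < (z + t • e₂) 1 := hzt
    rw [add_smul_e₂_one] at this
    linarith
  have h5 : (fun z => liftedField t τ H z i j) =
      fun z => {z : Plane | t < z 1}.indicator (fun z => H (z - t • e₂) i j) z +
        {z : Plane | t < z 1}ᶜ.indicator (fun _ => layerMatrix τ i j) z := by
    funext z
    by_cases hz : t < z 1
    · simp [liftedField, hz]
    · simp [liftedField, hz]
  rw [h5]
  refine MemLp.add ?_ ((memLp_const _).indicator hupper.compl)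
  rw [memLp_indicator_iff_restrict hupper, Measure.restrict_restrict hupper, inter_comm]
  exact h2

/-- The part above `y = t` is a translate of a subset of the old film, and the rest lies in an `ℓ ×
t` rectangle. -/
theorem lintegral_liftedField_le {ℓ lam mu : ℝ} (ht : 0 ≤ t) (hgm : Measurable g)
    (hgh : ∀ x, g x ≤ t + h x) :
    ∫⁻ z in film ℓ g, ENNReal.ofReal (elasticDensity lam mu (symPart (liftedField t τ H z))) ≤
      (∫⁻ z in film ℓ h, ENNReal.ofReal (elasticDensity lam mu (symPart (H z)))) +
        ENNReal.ofReal (elasticDensity lam mu (symPart (layerMatrix τ))) *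
          ENNReal.ofReal (t * ℓ) := by
  have hupper : MeasurableSet {z : Plane | t < z 1} :=
    (isOpen_lt continuous_const (by fun_prop : Continuous fun w : Plane => w 1)).measurableSet
  have hmp := measurePreserving_add_right_smul (t • e₂)
  have hemb := (MeasurableEquiv.addRight (t • e₂ : Plane)).measurableEmbedding
  have hfilm := measurableSet_film ℓ hgm
  rw [← lintegral_inter_add_sdiff _ (film ℓ g) hupper]
  refine add_le_add ?_ ?_
  · rw [← hmp.setLIntegral_comp_preimage_emb hemb]
    have hsub : (MeasurableEquiv.addRight (t • e₂ : Plane)) ⁻¹' (film ℓ g ∩ {z | t < z 1}) ⊆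
        film ℓ h := by
      rintro z ⟨⟨h1, h2, h3⟩, h4⟩
      simp only [MeasurableEquiv.coe_addRight, add_smul_e₂_zero, add_smul_e₂_one,
        mem_ofPred_eq] at h1 h2 h3 h4
      exact ⟨h1, by linarith, by linarith [hgh (z 0)]⟩
    refine le_trans (le_of_eq ?_) (lintegral_mono_set hsub)
    refine setLIntegral_congr_fun
      ((MeasurableEquiv.addRight (t • e₂ : Plane)).measurable (hfilm.inter hupper)) ?_
    rintro z ⟨_, hz⟩
    have : t < (z + t • e₂) 1 := hz
    simp only [liftedField, MeasurableEquiv.coe_addRight, if_pos this, add_sub_cancel_right]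
  · have h1 : ∀ z ∈ film ℓ g \ {z | t < z 1},
        ENNReal.ofReal (elasticDensity lam mu (symPart (liftedField t τ H z))) =
          ENNReal.ofReal (elasticDensity lam mu (symPart (layerMatrix τ))) := by
      intro z hz
      have : ¬t < z 1 := hz.2
      rw [liftedField, if_neg this]
    rw [setLIntegral_congr_fun (hfilm.diff hupper) h1, setLIntegral_const]
    gcongr
    have hsub : film ℓ g \ {z | t < z 1} ⊆
        planeEquiv ⁻¹' (Ico 0 ℓ ×ˢ Icc 0 t) := fun z hz =>
      ⟨hz.1.1, hz.1.2.1.le, not_lt.1 hz.2⟩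
    refine (measure_mono hsub).trans (le_of_eq ?_)
    rw [measurePreserving_planeEquiv.measure_preimage_equiv, Measure.volume_eq_prod,
      Measure.prod_prod, Real.volume_Ico, Real.volume_Icc, sub_zero, sub_zero, mul_comm,
      ENNReal.ofReal_mul ht]

end Lift

/-! ### Opening a vertical cut -/

section Competitor

variable {k : ℕ} {ℓ r₀ e₀ c δ x₀ t : ℝ} {ϱ : Mollifier} {b : Fin k → Plane} {h : ℝ → ℝ}
  {H : Plane → Mat}

/-- The lifted and notched film is admissible. -/
theorem admissible_notchedProfile (hℓ : 0 < ℓ) (hr₀ : 0 < r₀) {z : Fin k → Plane}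
    (hz : ∀ i, z i ∈ film ℓ h ∧ Metric.ball (z i) r₀ ⊆ filmSharp h)
    (hadm : Admissible ℓ r₀ e₀ ϱ b h (dislocationMeasure ℓ b z) H) (hle : ∀ x, h x ≤ c)
    {D : ℝ} (hD : 0 < D) (hDr : D ≤ r₀) (hcut : h x₀ ≤ c - D) (ht : 0 ≤ t) (hδ : 0 ≤ δ)
    (hδD : δ ≤ D / 8) (hx₀ : x₀ ∈ Ico 0 ℓ) (hxδ : x₀ + δ < ℓ) :
    Admissible ℓ r₀ e₀ ϱ b (notchedProfile ℓ c δ x₀ t h)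
      (dislocationMeasure ℓ b fun i => z i + t • e₂) (liftedField t (e₀ • e₁) H) := by
  have hh := hadm.profile
  have hδc : δ ≤ c := by linarith [hh.nonneg x₀]
  have hprof := admissibleProfile_notchedProfile (t := t) hℓ hh ht hδ hδc hx₀ hxδ
  have hgh : ∀ x, notchedProfile ℓ c δ x₀ t h x ≤ t + h x := notchedProfile_le
  have hGeq : regularized ϱ r₀ (dislocationMeasure ℓ b fun i => z i + t • e₂) =
      fun w => regularized ϱ r₀ (dislocationMeasure ℓ b z) (w - t • e₂) := by
    funext w; exact regularized_shift ϱ b z (t • e₂) w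
  have htr := hasTangentialTrace_liftedField ht hh.lowerSemicontinuous hgh
    hadm.memHcurl.memLp_loc (fun w hw => regularized_eq_zero ϱ b z hr₀ fun i => by
      linarith [le_height_of_ball_subset (hz i).1.2.1.le (hz i).2]) hadm.trace_eq
  rw [← hGeq, ← periodicExt_liftedField] at htr
  -- The core disks stay below the notch, so after the lift they still lie in the film.
  have hnotch : ∀ i, ∀ w ∈ Metric.ball (z i) r₀, w 1 < notch ℓ c δ x₀ (w 0) := fun i w hw =>
    lt_notch_of_mem_ball hℓ hr₀ hh hle hD hDr hcut hδD ((hz i).1.2.2.le.trans (hle _))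
      (hz i).2 hw hδ
  have hball : ∀ i, Metric.ball (z i + t • e₂) r₀ ⊆ filmSharp (notchedProfile ℓ c δ x₀ t h) := by
    intro i w hw
    have hw' : w - t • e₂ ∈ Metric.ball (z i) r₀ := by
      rw [Metric.mem_ball, dist_eq_norm] at hw ⊢
      rwa [sub_sub, add_comm (t • e₂)]
    have h1 := (hz i).2 hw'
    have h2 := hnotch i _ hw'
    have h3 : 0 < (w - t • e₂) 1 := h1.1
    have h4 : (w - t • e₂) 1 < h ((w - t • e₂) 0) := h1.2
    rw [sub_smul_e₂_one] at h2 h3 h4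
    rw [sub_smul_e₂_zero] at h2 h4
    refine ⟨by linarith, ?_⟩
    have := lt_min h4 h2
    unfold notchedProfile; linarith
  refine ⟨hprof, ⟨_, fun i => ⟨⟨?_, ?_⟩, hball i⟩, rfl⟩, ⟨?_, ?_⟩, htr.isWeakCurl, htr⟩
  · rw [add_smul_e₂_zero]; exact (hz i).1.1
  · exact hball i (Metric.mem_ball_self hr₀)
  · intro K hK hKg i j
    rw [periodicExt_liftedField]
    exact memLp_loc_liftedField hprof.lowerSemicontinuous hgh hadm.memHcurl.memLp_loc hK hKg i j
  · exact exists_curl_of_continuous (continuous_regularized ϱ b _ hℓ)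
      (fun x => (hgh x).trans (add_le_add_right (hle x) t)) htr.isWeakCurl

open scoped MeasureTheory in
theorem totalEnergy_notchedProfile_le {lam mu γ : ℝ} (hℓ : 0 < ℓ) (hh : AdmissibleProfile ℓ h)
    (hc : ∀ x, Tendsto h (𝓝[≠] x) (𝓝 c)) (ht : 0 ≤ t) (hδ : 0 ≤ δ) (hδc : δ ≤ c)
    (hx₀ : x₀ ∈ Ico 0 ℓ) (hxδ : x₀ + δ < ℓ) (τ : Plane) :
    totalEnergy ℓ lam mu γ (notchedProfile ℓ c δ x₀ t h) (liftedField t τ H) ≤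
      (∫⁻ z in film ℓ h, ENNReal.ofReal (elasticDensity lam mu (symPart (H z)))) +
        ENNReal.ofReal (elasticDensity lam mu (symPart (layerMatrix τ))) * ENNReal.ofReal (t * ℓ) +
        ENNReal.ofReal γ * ENNReal.ofReal (ℓ + √2 * δ) +
        2 * ENNReal.ofReal γ * μH[1] (verticalCracks ℓ (notchedProfile ℓ c δ x₀ t h)) := by
  have hprof := admissibleProfile_notchedProfile (t := t) hℓ hh ht hδ hδc hx₀ hxδ
  unfold totalEnergy
  gcongr
  · exact lintegral_liftedField_le ht hprof.lowerSemicontinuous.measurable notchedProfile_le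
  · exact hausdorffMeasure_graphSet_notchedProfile_le hℓ hδ hx₀ hxδ hc

end Competitor

/-- The energy balance of a small notch: opening a cut of depth `δ` saves more length than the
notch and the compensating layer cost. -/
theorem not_energy_le {E s s' : ENNReal} {W γ δ ℓ T : ℝ} (hγ : 0 < γ) (hδ : 0 < δ) (hℓ : 0 < ℓ)
    (hT : T = δ ^ 2 / 2) (hW : W * δ < γ) (hs : s + ENNReal.ofReal δ ≤ s')
    (hfin : E + ENNReal.ofReal γ * ENNReal.ofReal ℓ + 2 * ENNReal.ofReal γ * s' ≠ ⊤) :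
    ¬E + ENNReal.ofReal γ * ENNReal.ofReal ℓ + 2 * ENNReal.ofReal γ * s' ≤
      E + ENNReal.ofReal W * ENNReal.ofReal T + ENNReal.ofReal γ * ENNReal.ofReal (ℓ + √2 * δ) +
        2 * ENNReal.ofReal γ * s := by
  intro hle
  have hγ' : ENNReal.ofReal γ ≠ 0 := by simpa using hγ
  have hE : E ≠ ⊤ := fun h => hfin (by simp [h])
  have hs' : s' ≠ ⊤ := fun h => hfin (by
    rw [h, ENNReal.mul_top (mul_ne_zero two_ne_zero hγ'), add_top])
  have hsf : s ≠ ⊤ := fun h => hs' (top_le_iff.1 (by simpa [h] using hs))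
  have hle' : E + ENNReal.ofReal γ * ENNReal.ofReal ℓ +
      2 * ENNReal.ofReal γ * (s + ENNReal.ofReal δ) ≤
      E + ENNReal.ofReal W * ENNReal.ofReal T + ENNReal.ofReal γ * ENNReal.ofReal (ℓ + √2 * δ) +
        2 * ENNReal.ofReal γ * s := le_trans (by gcongr) hle
  have h2 : 0 ≤ √2 := Real.sqrt_nonneg 2
  have hT0 : 0 ≤ T := by rw [hT]; positivity
  have hreal := ENNReal.toReal_mono (by finiteness) hle'
  rw [ENNReal.toReal_add (by finiteness) (by finiteness),
    ENNReal.toReal_add (by finiteness) (by finiteness),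
    ENNReal.toReal_add (by finiteness) (by finiteness),
    ENNReal.toReal_add (by finiteness) (by finiteness),
    ENNReal.toReal_add (by finiteness) (by finiteness)] at hreal
  simp only [ENNReal.toReal_mul, ENNReal.toReal_add hsf ENNReal.ofReal_ne_top,
    ENNReal.toReal_ofReal', max_eq_left hγ.le, max_eq_left hℓ.le, max_eq_left hδ.le,
    max_eq_left hT0, max_eq_left (show 0 ≤ ℓ + √2 * δ by positivity), ENNReal.toReal_ofNat] at hreal
  -- `ENNReal.ofReal` truncates `W` at `0`.
  have hWδ : max W 0 * δ < γ := by
    rcases le_total W 0 with h | h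
    · rw [max_eq_right h, zero_mul]; exact hγ
    · rwa [max_eq_left h]
  -- The gain `(2 - √2) * γ * δ` thus exceeds `γ * δ / 2`, which bounds the energy of the layer.
  have h3 : √2 < 3 / 2 := by
    rw [Real.sqrt_lt' (by norm_num)]; norm_num
  have h4 : max W 0 * T ≤ γ * δ / 2 := by
    rw [hT]; nlinarith
  have h5 : √2 * (γ * δ) < 3 / 2 * (γ * δ) := mul_lt_mul_of_pos_right h3 (mul_pos hγ hδ)
  nlinarith

end EpitaxialFilm

end

/-! ### Contradiction with minimality. -/

open EpitaxialFilm
theorem mainTheorem10 {k : ℕ} (ℓ r₀ e₀ lam mu γ d : ℝ)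
    (hℓ : 0 < ℓ) (hr₀ : 0 < r₀) (hr₀ℓ : r₀ < ℓ / 2) (he₀ : e₀ ≠ 0)
    (hmu : 0 < mu) (hlam : 0 < mu + lam) (hγ : 0 < γ) (hd : 0 < d)
    (ϱ : Mollifier) (b : Fin k → Plane)
    (h : ℝ → ℝ) (σ : RadonVec) (H : Plane → Mat)
    (hmin : IsVolumeConstrainedMinimizer ℓ r₀ e₀ lam mu γ d ϱ b h σ H)
    (hflat : ∃ c : ℝ, ∀ x : ℝ, lowerLim h x = c) :
    verticalCracks ℓ h = ∅ := by
  obtain ⟨c, hc⟩ := hflat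
  have hadm := hmin.admissible
  have hh := hadm.profile
  have htend := hh.tendsto_of_lowerLim_eq hℓ hc
  have hle : ∀ x, h x ≤ c := fun x => hh.le_of_tendsto_punctured (htend x)
  have hae := hh.ae_eq_of_tendsto_punctured htend
  obtain ⟨z, hz, rfl⟩ := hadm.dislocation
  by_contra hne
  obtain ⟨p, hp, hcut, -, -⟩ := nonempty_iff_ne_empty.2 hne
  rw [hc] at hcut
  set x₀ := p 0
  have hc0 : 0 < c := (hh.nonneg x₀).trans_lt hcut
  have hvol : ENNReal.ofReal (c * ℓ) = ENNReal.ofReal d := by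
    rw [← hmin.volume_eq, volume_film_of_ae_eq hc0.le hh.lowerSemicontinuous.measurable hae]
  have hflatadm := admissible_primitiveField (r₀ := r₀) (e₀ := e₀) hℓ hc0.le ϱ b z fun i =>
    ⟨⟨(hz i).1.1, (hz i).1.2.1, (hz i).1.2.2.trans_le (hle _)⟩,
      fun w hw => ⟨((hz i).2 hw).1, ((hz i).2 hw).2.trans_le (hle _)⟩⟩
  have hfin := (hmin.le_energy _ _ _ hflatadm ((volume_film_const hc0.le).trans hvol)).trans_lt
    (totalEnergy_primitiveField_lt_top (continuous_regularized ϱ b z hℓ))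
  set W := elasticDensity lam mu (symPart (layerMatrix (e₀ • e₁)))
  have hD : 0 < min r₀ (c - h x₀) := lt_min hr₀ (sub_pos.2 hcut)
  -- The three bounds keep the notch away from the cores, keep it inside the period, and make the
  -- energy of the layer smaller than the gain in length.
  obtain ⟨δ, hδ, hδ'⟩ : ∃ δ : ℝ, 0 < δ ∧
      δ < min (min r₀ (c - h x₀) / 8) (min (ℓ - x₀) (γ / (|W| + 1))) :=
    exists_between (lt_min (by positivity) (lt_min (sub_pos.2 hp.2) (by positivity)))
  obtain ⟨hδD, hδℓW⟩ := lt_min_iff.1 hδ'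
  obtain ⟨hδℓ, hδW⟩ := lt_min_iff.1 hδℓW
  have hDc : min r₀ (c - h x₀) ≤ c - h x₀ := min_le_right _ _
  have hδc : δ ≤ c := by linarith [hh.nonneg x₀]
  have hxδ : x₀ + δ < ℓ := by linarith
  -- With this lift the layer has the area of the removed triangle.
  have ht : 0 ≤ δ ^ 2 / (2 * ℓ) := by positivity
  have htℓ : δ ^ 2 / (2 * ℓ) * ℓ = δ ^ 2 / 2 := by field_simp
  have hWδ : W * δ < γ := by
    rw [lt_div_iff₀ (by positivity)] at hδW
    nlinarith [le_abs_self W]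
  have hcomp := admissible_notchedProfile hℓ hr₀ hz hadm hle hD (min_le_left _ _)
    (by linarith) ht hδ.le hδD.le hp hxδ
  have hvolcomp : volume (film ℓ (notchedProfile ℓ c δ x₀ (δ ^ 2 / (2 * ℓ)) h)) =
      ENNReal.ofReal d := by
    rw [volume_film_notchedProfile hℓ ht hδ.le hδc hp hxδ hh hae, ← hvol]
    congr 1
    linarith
  have hener := (hmin.le_energy _ _ _ hcomp hvolcomp).trans
    (totalEnergy_notchedProfile_le hℓ hh htend ht hδ.le hδc hp hxδ _)
  have hcracks := hausdorffMeasure_verticalCracks_notchedProfile_add_le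
    (t := δ ^ 2 / (2 * ℓ)) hℓ hδ hp hxδ htend (by linarith)
  rw [totalEnergy, hausdorffMeasure_graphSet htend] at hener hfin
  exact not_energy_le hγ hδ hℓ htℓ hWδ hcracks hfin.ne hener
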